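/- For $\delta\in\mathbb R$ let $\Omega_\delta=\{s\in\mathbb C:\operatorname{Re}s>\delta\}$, and for $N\in\mathbb N$ let $\langle P_N\rangle$ be the set of positive integers all of whose prime factors are among the first $N$ primes. Let $\mathbf w=\{w_n\}_{n\ge1}$ be a sequence of positive real numbers and let $\delta,\Delta,\Delta'$ be real numbers with $0\le\delta=\Delta\le\Delta'$ such that 1. $\sum_{n=1}^\infty w_n^{-1}n^{-2\sigma'}<\infty$ for every $\sigma'>\Delta'$; 2. $\sum_{n\in\langle P_N\rangle}w_n^{-1}n^{-2\sigma}<\infty$ for every $N$ and every $\sigma>\Delta$; 3. $\mathbf w$ is multiplicative: $w_{mn}=w_mw_n$ whenever $\gcd(m,n)=1$ (so $w_1=1$); 4. $w_{p^k}\le p^{-2\delta}w_{p^{k-1}}$ for every prime $p$ and every integer $k\ge1$. Let $\mathcal H^{\mathbf w}$ be the Hilbert space of Dirichlet series $f(s)=\sum_{n\ge1}a_nn^{-s}$ with $\sum_n|a_n|^2w_n<\infty$ and inner product $\langle\sum a_nn^{-s},\sum b_nn^{-s}\rangle=\sum_na_n\overline{b_n}w_n$; by condition 1 these series converge absolutely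 in $\Omega_{\Delta'}$. A multiplier of $\mathcal H^{\mathbf w}$ is a function $\varphi$ on $\Omega_{\Delta'}$ such that for each $f\in\mathcal H^{\mathbf w}$ the product $\varphi f$ is represented on $\Omega_{\Delta'}$ by an element $M_\varphi f$ of $\mathcal H^{\mathbf w}$. Then for every multiplier $\varphi$ the operator $M_\varphi$ is bounded on $\mathcal H^{\mathbf w}$. Let $\mathfrak M$ be the algebra of the operators $M_\varphi$, a subalgebra of the bounded operators on $\mathcal H^{\mathbf w}$, with the operator norm. Let $H^\infty(\Omega_\delta)\cap\mathcal D$ be the algebra of bounded holomorphic functions on $\Omega_\delta$ that are represented by a Dirichlet series $\sum a_nn^{-s}$ converging in some right half-plane, with the norm $|\varphi|_{\Omega_\delta}=\sup_{s\in\Omega_\delta}|\varphi(s)|$. Then $\mathfrak M$ is isometrically isomorphic, as an algebra, to $H^\infty(\Omega_\delta)\cap\mathcal D$. More precisely, there is an isometric algebra isomorphism of $\mathfrak M$ onto $H^\infty(\Omega_\delta)\cap\mathcal D$ sending $M_\varphi$ to the function in $H^\infty(\Omega_\delta)\cap\mathcal D$ that agrees with $\varphi$ on $\Omega_{\Delta'}$.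 -/

import Mathlib

open Filter Topology

noncomputable section

namespace DirichletMultiplier

/-- The open right half-plane of complex numbers with real part greater than `δ`. -/
def halfPlane (δ : ℝ) : Set ℂ := {s | δ < s.re}

/-- The words generated by the first `N` primes: the positive integers all of whose prime factors
are among the first `N` primes. -/
def primeWords (N : ℕ) : Set ℕ :=
  Nat.factoredNumbers ((Finset.range N).image (Nat.nth Nat.Prime))

/-! ### The weighted Hilbert space of Dirichlet series

Sequences indexed by the positive integers are arithmetic functions, that is, functions on `ℕ`
with value `0` at `0`. A Dirichlet series in the space is given by its coefficient sequence `a`;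
the function it represents is `LSeries a`. -/

lemma summable_inner_aux {w : ArithmeticFunction ℝ} (hw : ∀ n, n ≠ 0 → 0 < w n)
    {a b : ArithmeticFunction ℂ}
    (ha : Summable fun n : ℕ => ‖a n‖ ^ 2 * w n) (hb : Summable fun n : ℕ => ‖b n‖ ^ 2 * w n) :
    Summable fun n : ℕ => b n * (starRingEnd ℂ) (a n) * (w n : ℂ) := by
  refine Summable.of_norm_bounded (ha.add hb) fun n => ?_
  have h0 : 0 ≤ w n := by
    rcases eq_or_ne n 0 with rfl | h
    · simp
    · exact (hw n h).le
  rw [norm_mul, norm_mul, RCLike.norm_conj, Complex.norm_real, Real.norm_of_nonneg h0, ← add_mul]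
  refine mul_le_mul_of_nonneg_right ?_ h0
  nlinarith [sq_nonneg (‖a n‖ - ‖b n‖), sq_nonneg ‖a n‖, sq_nonneg ‖b n‖]

/-- The space of Dirichlet series `∑ aₙ n⁻ˢ` with `∑ |aₙ|² wₙ < ∞`. -/
def space (w : ArithmeticFunction ℝ) (hw : ∀ n, n ≠ 0 → 0 < w n) :
    Submodule ℂ (ArithmeticFunction ℂ) where
  carrier := {a | Summable fun n : ℕ => ‖a n‖ ^ 2 * w n}
  zero_mem' := by simp [summable_zero]
  add_mem' := by
    intro a b ha hb
    refine Summable.of_norm_bounded ((ha.add hb).mul_left 2) fun n => ?_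
    have h0 : 0 ≤ w n := by
      rcases eq_or_ne n 0 with rfl | h
      · simp
      · exact (hw n h).le
    rw [Real.norm_of_nonneg (by positivity), ← add_mul, ← mul_assoc, ArithmeticFunction.add_apply]
    refine mul_le_mul_of_nonneg_right ?_ h0
    nlinarith [sq_nonneg (‖a n‖ - ‖b n‖), norm_add_le (a n) (b n), norm_nonneg (a n + b n)]
  smul_mem' := by
    intro c a ha
    refine (Summable.mul_left (‖c‖ ^ 2) ha).congr fun n => ?_
    simp [mul_pow, mul_assoc]

variable (w : ArithmeticFunction ℝ) (hw : ∀ n, n ≠ 0 → 0 < w n)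

/-- The inner product `∑ aₙ conj(bₙ) wₙ` of `∑ aₙ n⁻ˢ` and `∑ bₙ n⁻ˢ`. (In Mathlib's convention an
inner product is linear in its second argument.) -/
abbrev innerCore : InnerProductSpace.Core ℂ (space w hw) where
  inner b a := ∑' n : ℕ, a.1 n * (starRingEnd ℂ) (b.1 n) * (w n : ℂ)
  conj_inner_symm a b := by
    rw [Complex.conj_tsum]
    refine tsum_congr fun n => ?_
    simp [mul_comm]
  re_inner_nonneg a := by
    have h : ∀ n : ℕ, a.1 n * (starRingEnd ℂ) (a.1 n) * (w n : ℂ) =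
        ((‖a.1 n‖ ^ 2 * w n : ℝ) : ℂ) := fun n => by
      rw [Complex.mul_conj, Complex.normSq_eq_norm_sq]; push_cast; ring
    simp_rw [h, ← Complex.ofReal_tsum]
    refine tsum_nonneg fun n => ?_
    rcases eq_or_ne n 0 with rfl | hn
    · simp
    · have := hw n hn
      positivity
  add_left a b c := by
    rw [← Summable.tsum_add (summable_inner_aux hw a.2 c.2) (summable_inner_aux hw b.2 c.2)]
    refine tsum_congr fun n => ?_
    simp; ring
  smul_left a b r := by
    rw [← tsum_mul_left]
    refine tsum_congr fun n => ?_
    simp; ring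
  definite a h := by
    have h' : ∀ n : ℕ, a.1 n * (starRingEnd ℂ) (a.1 n) * (w n : ℂ) =
        ((‖a.1 n‖ ^ 2 * w n : ℝ) : ℂ) := fun n => by
      rw [Complex.mul_conj, Complex.normSq_eq_norm_sq]; push_cast; ring
    simp_rw [h', ← Complex.ofReal_tsum] at h
    have h0 : ∀ n : ℕ, 0 ≤ ‖a.1 n‖ ^ 2 * w n := fun n => by
      rcases eq_or_ne n 0 with rfl | hn
      · simp
      · have := hw n hn
        positivity
    have hs : HasSum (fun n : ℕ => ‖a.1 n‖ ^ 2 * w n) 0 := by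
      have := (show Summable fun n : ℕ => ‖a.1 n‖ ^ 2 * w n from a.2).hasSum
      rwa [Complex.ofReal_eq_zero.mp h] at this
    have hz := (hasSum_zero_iff_of_nonneg h0).mp hs
    ext n
    rcases eq_or_ne n 0 with rfl | hn
    · simp
    · have := congrFun hz n
      simpa [(hw n hn).ne'] using this

instance : NormedAddCommGroup (space w hw) := (innerCore w hw).toNormedAddCommGroup

instance : InnerProductSpace ℂ (space w hw) :=
  InnerProductSpace.ofCore (innerCore w hw).toCore

lemma inner_eq (a b : space w hw) :
    inner ℂ b a = ∑' n : ℕ, a.1 n * (starRingEnd ℂ) (b.1 n) * (w n : ℂ) := rfl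

lemma norm_sq_eq (a : space w hw) : ‖a‖ ^ 2 = ∑' n : ℕ, ‖a.1 n‖ ^ 2 * w n := by
  have h' : ∀ n : ℕ, a.1 n * (starRingEnd ℂ) (a.1 n) * (w n : ℂ) =
      ((‖a.1 n‖ ^ 2 * w n : ℝ) : ℂ) := fun n => by
    rw [Complex.mul_conj, Complex.normSq_eq_norm_sq]; push_cast; ring
  rw [norm_sq_eq_re_inner (𝕜 := ℂ), inner_eq]
  simp_rw [h', ← Complex.ofReal_tsum]
  rfl

/-- The square root of the weights maps the space isometrically onto `ℓ²`. -/
def toL2 : space w hw ≃ₗᵢ[ℂ] lp (fun _ : ℕ+ => ℂ) 2 where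
  toFun a := ⟨fun n => (√(w n) : ℂ) * a.1 n, by
    refine memℓp_gen ?_
    have h : Summable fun n : ℕ => ‖a.1 n‖ ^ 2 * w n := a.2
    refine (h.comp_injective PNat.coe_injective).congr fun n => ?_
    have := Real.sq_sqrt (hw n n.ne_zero).le
    simp [mul_pow, this, mul_comm]⟩
  map_add' a b := by
    ext n
    change (√(w n) : ℂ) * (a.1 n + b.1 n) = √(w n) * a.1 n + √(w n) * b.1 n
    ring
  map_smul' c a := by
    ext n
    simp
    ring
  invFun x := ⟨⟨fun n => if h : 0 < n then (√(w n) : ℂ)⁻¹ * x ⟨n, h⟩ else 0, by simp⟩, by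
    have h : Summable fun n : ℕ+ => ‖x n‖ ^ 2 := by
      simpa using (lp.memℓp x).summable (by norm_num)
    refine (Function.Injective.summable_iff PNat.coe_injective ?_).mp ?_
    · intro n hn
      have : n = 0 := by
        by_contra h0
        exact hn ⟨⟨n, Nat.pos_of_ne_zero h0⟩, rfl⟩
      simp [this]
    · refine h.congr fun n => ?_
      have h1 := hw n n.ne_zero
      have h2 := Real.sq_sqrt h1.le
      simp [mul_pow, h2]
      field_simp
      rfl⟩
  left_inv a := by
    ext n
    rcases Nat.eq_zero_or_pos n with rfl | hn
    · simp
    · have h1 := (Real.sqrt_pos.mpr (hw n hn.ne')).ne'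
      simp [hn, h1]
  right_inv x := by
    ext n
    have h1 := (Real.sqrt_pos.mpr (hw n n.ne_zero)).ne'
    simp [h1]
    rfl
  norm_map' a := by
    have h1 := lp.norm_rpow_eq_tsum (p := 2) (by norm_num)
      (⟨fun n => (√(w n) : ℂ) * a.1 n, by
        refine memℓp_gen ?_
        have h : Summable fun n : ℕ => ‖a.1 n‖ ^ 2 * w n := a.2
        refine (h.comp_injective PNat.coe_injective).congr fun n => ?_
        have := Real.sq_sqrt (hw n n.ne_zero).le
        simp [mul_pow, this, mul_comm]⟩ : lp (fun _ : ℕ+ => ℂ) 2)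
    have h2 := norm_sq_eq w hw a
    have h3 : ∑' n : ℕ, ‖a.1 n‖ ^ 2 * w n = ∑' n : ℕ+, ‖a.1 n‖ ^ 2 * w n := by
      refine (Function.Injective.tsum_eq PNat.coe_injective ?_).symm
      intro n hn
      refine ⟨⟨n, Nat.pos_of_ne_zero ?_⟩, rfl⟩
      rintro rfl
      simp at hn
    have h4 : ∀ n : ℕ+, ‖(√(w n) : ℂ) * a.1 n‖ ^ 2 = ‖a.1 n‖ ^ 2 * w n := fun n => by
      have := Real.sq_sqrt (hw n n.ne_zero).le
      simp [mul_pow, this, mul_comm]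
    simp only [ENNReal.toReal_ofNat, Real.rpow_ofNat, h4] at h1
    rw [h3, ← h1] at h2
    exact ((sq_eq_sq₀ (norm_nonneg _) (norm_nonneg _)).mp h2).symm

instance : CompleteSpace (space w hw) :=
  (completeSpace_congr (e := (toL2 w hw).toEquiv)
    (toL2 w hw).isometry.isUniformEmbedding).mpr inferInstance

/-! ### Multipliers -/

/-- The standing assumption on the weights: `∑ wₙ⁻¹ n^(-2σ) < ∞` for every `σ > σ₀`. -/
def SummableWeight (σ₀ : ℝ) : Prop :=
  ∀ σ : ℝ, σ₀ < σ → Summable fun n : ℕ => (w n)⁻¹ * (n : ℝ) ^ (-(2 * σ))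

variable {w hw} in
/-- Under the standing assumption every series in the space converges absolutely in the half-plane
with abscissa `σ₀`. -/
lemma lseriesSummable {σ₀ : ℝ} (hs : SummableWeight w σ₀) (f : space w hw) {s : ℂ}
    (h : s ∈ halfPlane σ₀) : LSeriesSummable f.1 s := by
  have hf : Summable fun n : ℕ => ‖f.1 n‖ ^ 2 * w n := f.2
  refine Summable.of_norm_bounded (hf.add (hs s.re h)) fun n => ?_
  rcases eq_or_ne n 0 with rfl | hn
  · simp
  have hw0 := hw n hn
  have hn0 : (0 : ℝ) < n := by positivity
  rw [LSeries.norm_term_eq, if_neg hn]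
  have e : (n : ℝ) ^ (-(2 * s.re)) = ((n : ℝ) ^ s.re)⁻¹ ^ 2 := by
    rw [← Real.rpow_neg hn0.le, ← Real.rpow_natCast, ← Real.rpow_mul hn0.le]
    congr 1; push_cast; ring
  rw [e, div_eq_mul_inv]
  set x := ‖f.1 n‖
  set y := ((n : ℝ) ^ s.re)⁻¹
  obtain ⟨r, hr, hrw⟩ : ∃ r : ℝ, 0 < r ∧ w n = r ^ 2 :=
    ⟨√(w n), Real.sqrt_pos.mpr hw0, (Real.sq_sqrt hw0.le).symm⟩
  have e2 : x * y = (x * r) * (r⁻¹ * y) := by field_simp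
  rw [e2, hrw, ← inv_pow, ← mul_pow, ← mul_pow]
  nlinarith [sq_nonneg (x * r - r⁻¹ * y), sq_nonneg (x * r), sq_nonneg (r⁻¹ * y)]

/-- `φ` is a multiplier (as a function on the half-plane with abscissa `σ₀`): for every `f` in the
space the product `φ f` is again in the space. -/
def IsMultiplier (σ₀ : ℝ) (φ : halfPlane σ₀ → ℂ) : Prop :=
  ∀ f : space w hw, ∃ g : space w hw, ∀ s : halfPlane σ₀, LSeries g.1 s = φ s * LSeries f.1 s

/-- The bounded operator `T` is the operator of multiplication by `φ`. -/
def IsMultiplicationBy (σ₀ : ℝ) (T : space w hw →L[ℂ] space w hw) (φ : halfPlane σ₀ → ℂ) : Prop :=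
  ∀ f : space w hw, ∀ s : halfPlane σ₀, LSeries (T f).1 s = φ s * LSeries f.1 s

/-- The algebra of multipliers, viewed as a subalgebra of the algebra of bounded operators: the
operators of multiplication by a multiplier. -/
def multiplierAlgebra (σ₀ : ℝ) (hs : SummableWeight w σ₀) :
    Subalgebra ℂ (space w hw →L[ℂ] space w hw) where
  carrier := {T | ∃ φ : halfPlane σ₀ → ℂ,
    IsMultiplier w hw σ₀ φ ∧ IsMultiplicationBy w hw σ₀ T φ}
  mul_mem' := by
    rintro S T ⟨φ, -, hS⟩ ⟨ψ, -, hT⟩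
    have h : IsMultiplicationBy w hw σ₀ (S * T) (φ * ψ) := fun f s => by
      change LSeries (S (T f)).1 s = _
      rw [hS, hT, Pi.mul_apply, mul_assoc]
    exact ⟨φ * ψ, fun f => ⟨_, h f⟩, h⟩
  add_mem' := by
    rintro S T ⟨φ, -, hS⟩ ⟨ψ, -, hT⟩
    have h : IsMultiplicationBy w hw σ₀ (S + T) (φ + ψ) := fun f s => by
      have e : (((S + T) f).1 : ℕ → ℂ) = ((S f).1 : ℕ → ℂ) + ((T f).1 : ℕ → ℂ) := rfl
      rw [e, LSeries_add (lseriesSummable hs _ s.2) (lseriesSummable hs _ s.2), hS, hT,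
        Pi.add_apply, add_mul]
    exact ⟨φ + ψ, fun f => ⟨_, h f⟩, h⟩
  algebraMap_mem' := by
    intro c
    have h : IsMultiplicationBy w hw σ₀ (algebraMap ℂ _ c) (fun _ => c) := fun f s => by
      have e : (((algebraMap ℂ (space w hw →L[ℂ] space w hw) c) f).1 : ℕ → ℂ) =
          c • (f.1 : ℕ → ℂ) := rfl
      rw [e, LSeries_smul]
    exact ⟨fun _ => c, fun f => ⟨_, h f⟩, h⟩

/-! ### Bounded holomorphic functions representable by Dirichlet series -/

/-- `F` is representable by a Dirichlet series in some right half-plane (convergence may be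
conditional). -/
def IsDirichletRepresentable {δ : ℝ} (F : halfPlane δ → ℂ) : Prop :=
  ∃ (a : ℕ → ℂ) (σ : ℝ), ∀ s : halfPlane δ, σ < (s : ℂ).re →
    Tendsto (fun N : ℕ => ∑ n ∈ Finset.Icc 1 N, a n * (n : ℂ) ^ (-(s : ℂ))) atTop (𝓝 (F s))

/-- `F` is holomorphic in the half-plane. -/
def IsHolomorphic {δ : ℝ} (F : halfPlane δ → ℂ) : Prop :=
  ∃ G : ℂ → ℂ, DifferentiableOn ℂ G (halfPlane δ) ∧ ∀ s : halfPlane δ, F s = G s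

lemma sum_term_eq (a : ℕ → ℂ) (s : ℂ) (N : ℕ) :
    ∑ n ∈ Finset.range (N + 1), LSeries.term a s n =
      ∑ n ∈ Finset.Icc 1 N, a n * (n : ℂ) ^ (-s) := by
  induction N with
  | zero => simp
  | succ N ih =>
    rw [Finset.sum_range_succ, ih, Finset.sum_Icc_succ_top (by omega),
      LSeries.term_of_ne_zero (by omega), Complex.cpow_neg, div_eq_mul_inv]

lemma isDirichletRepresentable_iff {δ : ℝ} (F : halfPlane δ → ℂ) :
    IsDirichletRepresentable F ↔
      ∃ (a : ℕ → ℂ) (σ : ℝ), ∀ s : halfPlane δ, σ < (s : ℂ).re → LSeriesHasSum a s (F s) := by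
  constructor
  · rintro ⟨a, σ, h⟩
    set x : ℝ := max δ σ + 1 with hx
    have hxδ : δ < x := by linarith [le_max_left δ σ]
    have hxσ : σ < x := by linarith [le_max_right δ σ]
    have h1 := h ⟨(x : ℂ), by simpa [halfPlane] using hxδ⟩ (by simpa using hxσ)
    have h2 : Tendsto (fun N : ℕ => LSeries.term a x N) atTop (𝓝 0) := by
      rw [← tendsto_add_atTop_iff_nat 1]
      have h3 := ((tendsto_add_atTop_iff_nat 1).mpr h1).sub h1
      rw [sub_self] at h3
      refine h3.congr fun N => ?_
      simp only [← sum_term_eq]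
      rw [Finset.sum_range_succ, add_sub_cancel_left]
    obtain ⟨C, hC⟩ := (Metric.isBounded_range_of_tendsto _ h2).exists_norm_le
    have hsum : ∀ s : ℂ, x + 1 < s.re → LSeriesSummable a s := fun s hs => by
      refine LSeriesSummable_of_le_const_mul_rpow hs ⟨C, fun n hn => ?_⟩
      have hn0 : (0 : ℝ) < n := by positivity
      have := hC _ ⟨n, rfl⟩
      rw [LSeries.norm_term_eq, if_neg hn, Complex.ofReal_re, div_le_iff₀ (by positivity)] at this
      simpa using this
    refine ⟨a, x + 1, fun s hs => ?_⟩
    have h4 := (hsum s hs).LSeriesHasSum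
    have h5 := (tendsto_add_atTop_iff_nat 1).mpr (HasSum.tendsto_sum_nat h4)
    simp only [sum_term_eq] at h5
    rwa [tendsto_nhds_unique h5 (h s (by linarith))] at h4
  · rintro ⟨a, σ, h⟩
    refine ⟨a, σ, fun s hs => ?_⟩
    simpa only [sum_term_eq] using
      (tendsto_add_atTop_iff_nat 1).mpr (HasSum.tendsto_sum_nat (h s hs))

open scoped BoundedContinuousFunction

/-- The algebra of bounded holomorphic functions on the half-plane with abscissa `δ` that are
representable by a Dirichlet series in some right half-plane. Its norm is the supremum norm, as a
subalgebra of the bounded continuous functions on the half-plane. -/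
def boundedDirichlet (δ : ℝ) : Subalgebra ℂ (halfPlane δ →ᵇ ℂ) where
  carrier := {F | IsHolomorphic F ∧ IsDirichletRepresentable F}
  mul_mem' := by
    rintro F G ⟨⟨F', hF', hF⟩, hFD⟩ ⟨⟨G', hG', hG⟩, hGD⟩
    rw [isDirichletRepresentable_iff] at hFD hGD
    obtain ⟨a, σ, ha⟩ := hFD
    obtain ⟨b, τ, hb⟩ := hGD
    refine ⟨⟨F' * G', hF'.mul hG', fun s => by simp [hF, hG]⟩, ?_⟩
    rw [isDirichletRepresentable_iff]
    exact ⟨_, max σ τ, fun s hs => by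
      simpa using LSeriesHasSum.convolution (ha s (lt_of_le_of_lt (le_max_left _ _) hs))
        (hb s (lt_of_le_of_lt (le_max_right _ _) hs))⟩
  add_mem' := by
    rintro F G ⟨⟨F', hF', hF⟩, hFD⟩ ⟨⟨G', hG', hG⟩, hGD⟩
    rw [isDirichletRepresentable_iff] at hFD hGD
    obtain ⟨a, σ, ha⟩ := hFD
    obtain ⟨b, τ, hb⟩ := hGD
    refine ⟨⟨F' + G', hF'.add hG', fun s => by simp [hF, hG]⟩, ?_⟩
    rw [isDirichletRepresentable_iff]
    exact ⟨_, max σ τ, fun s hs => by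
      simpa using LSeriesHasSum.add (ha s (lt_of_le_of_lt (le_max_left _ _) hs))
        (hb s (lt_of_le_of_lt (le_max_right _ _) hs))⟩
  algebraMap_mem' := by
    intro c
    refine ⟨⟨fun _ => c, differentiableOn_const c, fun s => rfl⟩, ?_⟩
    refine ⟨fun n => if n = 1 then c else 0, 0, fun s _ => ?_⟩
    refine tendsto_const_nhds.congr' ?_
    filter_upwards [eventually_ge_atTop 1] with N hN
    rw [Finset.sum_eq_single_of_mem 1 (Finset.mem_Icc.mpr ⟨le_rfl, hN⟩)
      (fun n _ hn => by simp [hn])]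
    simp

end DirichletMultiplier

end

open Filter Topology

noncomputable section

namespace DirichletMultiplier

/-! ### Means over vertical lines -/

/-! Two norm-decreasing constructions, from bounded functions to operators and from operators to
bounded functions, are inverse to each other; each rests on its own mechanism.

From a function to an operator. Let |F| ≤ B on Ω_δ. The functions n^(-s) are orthogonal for means
over vertical lines, and the means of a bounded holomorphic function do not depend on the line.
Hence the coefficients of F·P, with P a Dirichlet polynomial, can be read off on any line Re s = σ >
δ, although the series need converge only far to the right (`tendsto_lineMean_of_bounded`). Testing
F·P against its own truncation gives a mean-square inequality with weights n^(-2σ), and σ → δ gives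
the weights n^(-2δ) (`sum_norm_sq_le_of_bounded'`). When the index set consists of the divisors of
an integer, truncating the factor f loses nothing, since divisors of divisors are again divisors.
Conditions 3 and 4 say that w_n n^(2δ) is multiplicative and nonincreasing along prime powers, so
summation by parts over divisors replaces n^(-2δ) by w_n (`sum_divisors_weight_nonneg`). Divisors of
factorials exhaust the positive integers, which bounds the whole operator (`convolution_mem_space`).

From an operator to a function. The closed graph theorem makes every M_φ bounded, and φ is the
series M_φ 1. Discarding the coefficients outside ⟨P_N⟩ respects Dirichlet convolution, and by
condition 2 the restricted series can be evaluated, boundedly, at each s in Ω_δ. If z is the value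
obtained from φ, then M_φ^k 1 gives z^k, and taking k-th roots leaves |z| ≤ ‖M_φ‖
(`norm_lseries_restrictWords_le`). As N grows, these uniformly bounded functions converge uniformly
far to the right; the three lines theorem spreads the convergence over Ω_δ (`exists_bounded_limit`).
The limit extends φ and inherits the bound. The identity theorem makes the extension unique, so the
two norm inequalities combine to an isometry. -/

/-- The mean of `h` over the segment of the vertical line with abscissa `σ` between the heights
`-T` and `T`. -/
def lineMean (h : ℂ → ℂ) (σ T : ℝ) : ℂ :=
  (∫ t in -T..T, h (σ + t * Complex.I)) / (2 * T)

lemma norm_lineMean_le {h : ℂ → ℂ} {σ T C : ℝ} (hT : 0 < T)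
    (hC : ∀ t : ℝ, ‖h (σ + t * Complex.I)‖ ≤ C) : ‖lineMean h σ T‖ ≤ C := by
  have h1 := intervalIntegral.norm_integral_le_of_norm_le_const (a := -T) (b := T)
    (f := fun t : ℝ => h (σ + t * Complex.I)) (C := C) fun t _ => hC t
  have h2 : |T - -T| = 2 * T := by rw [abs_of_pos (by linarith)]; ring
  have h3 : ‖(2 * T : ℂ)‖ = 2 * T := by
    rw [← Complex.ofReal_ofNat, ← Complex.ofReal_mul, Complex.norm_real,
      Real.norm_of_nonneg (by linarith)]
  rw [lineMean, norm_div, h3, div_le_iff₀ (by linarith), ← h2]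
  exact h1

lemma lineMean_const_mul (c : ℂ) (h : ℂ → ℂ) (σ T : ℝ) :
    lineMean (fun s => c * h s) σ T = c * lineMean h σ T := by
  simp only [lineMean, intervalIntegral.integral_const_mul, mul_div_assoc]

lemma tendsto_div_two_mul_atTop (C : ℝ) : Tendsto (fun T : ℝ => C / (2 * T)) atTop (𝓝 0) :=
  tendsto_const_nhds.div_atTop (tendsto_id.const_mul_atTop two_pos)

/-- A nonconstant exponential has a bounded primitive along the line, and dividing by 2T sends it to
zero. -/
lemma tendsto_lineMean_exp {x : ℝ} (x0 : ℝ) (hx : x ≠ 0) :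
    Tendsto (lineMean (fun s => Complex.exp (x * s)) x0) atTop (𝓝 0) := by
  refine squeeze_zero_norm' ?_ (tendsto_div_two_mul_atTop
    ((Real.exp (x * x0) + Real.exp (x * x0)) / |x|))
  filter_upwards [eventually_gt_atTop 0] with T hT
  have hc : (x * Complex.I : ℂ) ≠ 0 := by simp [hx]
  have h3 : ‖(2 * T : ℂ)‖ = 2 * T := by
    rw [← Complex.ofReal_ofNat, ← Complex.ofReal_mul, Complex.norm_real,
      Real.norm_of_nonneg (by linarith)]
  have h4 : ∀ t : ℝ, Complex.exp (x * (x0 + t * Complex.I)) =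
      Complex.exp (x * x0) * Complex.exp (x * Complex.I * t) := fun t => by
    rw [← Complex.exp_add]; ring_nf
  have h5 : ∀ t : ℝ, ‖Complex.exp (x * Complex.I * t)‖ = 1 := fun t => by
    simp [Complex.norm_exp]
  simp only [lineMean, h4]
  rw [intervalIntegral.integral_const_mul, integral_exp_mul_complex hc, norm_div, h3, norm_mul,
    norm_div]
  have h6 : ‖Complex.exp (x * x0)‖ = Real.exp (x * x0) := by simp [Complex.norm_exp]
  have h7 : ‖(x * Complex.I : ℂ)‖ = |x| := by simp
  rw [h6, h7, ← mul_div_assoc]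
  refine div_le_div_of_nonneg_right (div_le_div_of_nonneg_right ?_ (abs_nonneg x)) (by linarith)
  have h8 := norm_sub_le (Complex.exp (x * Complex.I * T)) (Complex.exp (x * Complex.I * (-T : ℝ)))
  rw [h5, h5] at h8
  nlinarith [Real.exp_pos (x * x0)]

lemma lineMean_one {x0 T : ℝ} (hT : 0 < T) : lineMean (fun _ => 1) x0 T = 1 := by
  have : (T : ℂ) ≠ 0 := by exact_mod_cast hT.ne'
  simp [lineMean]
  field_simp
  norm_num

lemma term_mul_cpow_eq (b : ℕ → ℂ) (s : ℂ) {k n : ℕ} (hk : k ≠ 0) (hn : n ≠ 0) :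
    LSeries.term b s k * (n : ℂ) ^ s =
      b k * Complex.exp ((Real.log n - Real.log k : ℝ) * s) := by
  rw [LSeries.term_of_ne_zero hk, Complex.cpow_def_of_ne_zero (by exact_mod_cast hk),
    Complex.cpow_def_of_ne_zero (by exact_mod_cast hn), div_mul_eq_mul_div, mul_div_assoc,
    ← Complex.exp_sub, Complex.ofReal_sub, Complex.natCast_log, Complex.natCast_log]
  ring_nf

/-- Orthogonality: (n/k)^s has constant frequency log n - log k along the line, which vanishes only
for k = n. -/
lemma tendsto_lineMean_term {b : ℕ → ℂ} {n : ℕ} (hn : n ≠ 0) (x : ℝ) (k : ℕ) :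
    Tendsto (lineMean (fun s => LSeries.term b s k * (n : ℂ) ^ s) x) atTop
      (𝓝 (if k = n then b n else 0)) := by
  rcases eq_or_ne k 0 with rfl | hk
  · rw [if_neg (Ne.symm hn)]
    refine tendsto_const_nhds.congr fun T => ?_
    simp [lineMean]
  simp only [term_mul_cpow_eq b _ hk hn]
  rw [show lineMean (fun s => b k * Complex.exp ((Real.log n - Real.log k : ℝ) * s)) x =
    fun T => b k * lineMean (fun s => Complex.exp ((Real.log n - Real.log k : ℝ) * s)) x T from
    funext fun T => lineMean_const_mul _ _ _ _]
  split_ifs with h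
  · subst h
    refine tendsto_const_nhds.congr' ?_
    filter_upwards [eventually_gt_atTop 0] with T hT
    simp [lineMean_one hT]
  · have h1 : Real.log n - Real.log k ≠ 0 := fun h0 => h <| by
      have := Real.log_injOn_pos (Set.mem_Ioi.mpr (by positivity : (0 : ℝ) < n))
        (Set.mem_Ioi.mpr (by positivity : (0 : ℝ) < k)) (by linarith)
      exact_mod_cast this.symm
    simpa using (tendsto_lineMean_exp x h1).const_mul (b k)

lemma continuous_term (b : ℕ → ℂ) (k : ℕ) : Continuous fun s : ℂ => LSeries.term b s k := by
  rcases eq_or_ne k 0 with rfl | hk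
  · simpa using continuous_const
  have hk' : (k : ℂ) ≠ 0 := by exact_mod_cast hk
  simp only [LSeries.term_of_ne_zero hk]
  exact continuous_const.div (continuous_const.cpow continuous_id fun _ => by simp [hk])
    fun s => by simp [Complex.cpow_eq_zero_iff, hk']

lemma norm_natCast_cpow {n : ℕ} (hn : n ≠ 0) (s : ℂ) : ‖(n : ℂ) ^ s‖ = (n : ℝ) ^ s.re :=
  Complex.norm_natCast_cpow_of_pos (Nat.pos_of_ne_zero hn) s

/-- The coefficients of a Dirichlet series are its means over a line of absolute convergence. -/
lemma tendsto_lineMean_LSeries {b : ℕ → ℂ} {x : ℝ} (hb : LSeriesSummable b x) {n : ℕ}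
    (hn : n ≠ 0) :
    Tendsto (lineMean (fun s => LSeries b s * (n : ℂ) ^ s) x) atTop (𝓝 (b n)) := by
  have hn' : (n : ℂ) ≠ 0 := by exact_mod_cast hn
  have hbound : ∀ (k : ℕ) (t : ℝ), ‖LSeries.term b (x + t * Complex.I) k *
      (n : ℂ) ^ (x + t * Complex.I : ℂ)‖ ≤ ‖LSeries.term b x k‖ * (n : ℝ) ^ x := fun k t => by
    rw [norm_mul, norm_natCast_cpow hn, LSeries.norm_term_eq, LSeries.norm_term_eq]
    simp
  have hsum : Summable fun k => ‖LSeries.term b x k‖ * (n : ℝ) ^ x :=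
    (Summable.norm hb).mul_right _
  -- The bound does not depend on T, so the limit may be taken term by term; only the term k = n
  -- survives.
  have hkey := tendsto_tsum_of_dominated_convergence (𝓕 := atTop) hsum
    (fun k => tendsto_lineMean_term (b := b) hn x k) (by
      filter_upwards [eventually_gt_atTop 0] with T hT k
      exact norm_lineMean_le hT (hbound k))
  rw [tsum_ite_eq] at hkey
  refine hkey.congr' ?_
  filter_upwards [eventually_gt_atTop 0] with T hT
  have hs := intervalIntegral.hasSum_integral_of_dominated_convergence
    (μ := MeasureTheory.volume) (a := -T) (b := T)
    (F := fun (k : ℕ) (t : ℝ) => LSeries.term b (x + t * Complex.I) k *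
      (n : ℂ) ^ (x + t * Complex.I : ℂ))
    (f := fun t : ℝ => LSeries b (x + t * Complex.I) * (n : ℂ) ^ (x + t * Complex.I : ℂ))
    (fun k _ => ‖LSeries.term b x k‖ * (n : ℝ) ^ x)
    (fun k => by
      have h1 := (continuous_term b k).comp
        (by fun_prop : Continuous fun t : ℝ => (x + t * Complex.I : ℂ))
      have h2 : Continuous fun t : ℝ => (n : ℂ) ^ (x + t * Complex.I : ℂ) :=
        continuous_const.cpow (by fun_prop) fun _ => by simp [hn]
      exact (h1.mul h2).aestronglyMeasurable)
    (fun k => Eventually.of_forall fun t _ => hbound k t)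
    (Eventually.of_forall fun t _ => hsum)
    (by simp)
    (Eventually.of_forall fun t _ => by
      refine HasSum.mul_right _ ?_
      exact (hb.of_re_le_re (by simp)).hasSum)
  simp only [lineMean]
  rw [tsum_div_const, hs.tsum_eq]

/-- The mean of a bounded holomorphic function does not depend on the line. -/
lemma tendsto_lineMean_sub {H : ℂ → ℂ} {σ x C : ℝ} (hσ : σ ≤ x)
    (hd : DifferentiableOn ℂ H {s | σ ≤ s.re})
    (hC : ∀ s : ℂ, σ ≤ s.re → s.re ≤ x → ‖H s‖ ≤ C) :
    Tendsto (fun T => lineMean H x T - lineMean H σ T) atTop (𝓝 0) := by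
  -- By Cauchy's theorem on a rectangle the vertical integrals differ by the two horizontal sides,
  -- each at most C(x - σ) whatever T is.
  refine squeeze_zero_norm' ?_ (tendsto_div_two_mul_atTop (2 * (C * (x - σ))))
  filter_upwards [eventually_gt_atTop 0] with T hT
  have h3 : ‖(2 * T : ℂ)‖ = 2 * T := by
    rw [← Complex.ofReal_ofNat, ← Complex.ofReal_mul, Complex.norm_real,
      Real.norm_of_nonneg (by linarith)]
  have hr := Complex.integral_boundary_rect_eq_zero_of_differentiableOn H (σ + (-T : ℝ) * Complex.I)
    (x + T * Complex.I) (hd.mono fun s hs => by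
      have := hs.1
      simp [Set.uIcc_of_le hσ] at this
      exact this.1)
  simp only [Complex.add_re, Complex.ofReal_re, Complex.mul_re, Complex.I_re, mul_zero,
    Complex.ofReal_im, Complex.I_im, mul_one, sub_self, add_zero, Complex.add_im, Complex.mul_im,
    zero_add, smul_eq_mul] at hr
  have hor : ∀ y : ℝ, ‖∫ u in σ..x, H (u + y * Complex.I)‖ ≤ C * (x - σ) := fun y => by
    rw [← abs_of_nonneg (sub_nonneg.mpr hσ)]
    refine intervalIntegral.norm_integral_le_of_norm_le_const fun u hu => ?_
    rw [Set.uIoc_of_le hσ] at hu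
    exact hC _ (by simpa using hu.1.le) (by simpa using hu.2)
  set A := ∫ u in σ..x, H (u + (-T : ℝ) * Complex.I)
  set B := ∫ u in σ..x, H (u + T * Complex.I)
  have e : (∫ t in -T..T, H (x + t * Complex.I)) - ∫ t in -T..T, H (σ + t * Complex.I) =
      Complex.I * (A - B) := by
    linear_combination (-Complex.I) * hr + ((∫ t in -T..T, H (x + t * Complex.I)) -
      ∫ t in -T..T, H (σ + t * Complex.I)) * Complex.I_sq
  rw [lineMean, lineMean, ← sub_div, e, norm_div, h3, norm_mul, Complex.norm_I, one_mul]
  refine div_le_div_of_nonneg_right ?_ (by linarith)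
  have := norm_sub_le A B
  linarith [hor (-T), hor T]

/-- The coefficients of a bounded holomorphic function represented by a Dirichlet series are its
means over every vertical line in the half-plane of holomorphy. -/
lemma tendsto_lineMean_of_bounded {G : ℂ → ℂ} {δ B τ σ : ℝ} {b : ℕ → ℂ}
    (hd : DifferentiableOn ℂ G (halfPlane δ)) (hB : ∀ s ∈ halfPlane δ, ‖G s‖ ≤ B)
    (hb : ∀ s : ℂ, τ < s.re → LSeriesHasSum b s (G s)) (hσ : δ < σ) {n : ℕ} (hn : n ≠ 0) :
    Tendsto (lineMean (fun s => G s * (n : ℂ) ^ s) σ) atTop (𝓝 (b n)) := by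
  -- A line far enough right for absolute convergence; the mean computed there is then moved back to
  -- σ.
  set x := max σ (τ + 1)
  have hx : σ ≤ x := le_max_left _ _
  have hxτ : τ < x := lt_of_lt_of_le (by linarith) (le_max_right _ _)
  have hn' : (n : ℂ) ≠ 0 := by exact_mod_cast hn
  have h1 := tendsto_lineMean_LSeries (hb x (by simpa using hxτ)).LSeriesSummable hn
  have e : lineMean (fun s => LSeries b s * (n : ℂ) ^ s) x =
      lineMean (fun s => G s * (n : ℂ) ^ s) x := by
    funext T
    have : ∀ t : ℝ, LSeries b (x + t * Complex.I) = G (x + t * Complex.I) := fun t =>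
      (hb _ (by simpa using hxτ)).LSeries_eq
    simp only [lineMean, this]
  rw [e] at h1
  have hd' : DifferentiableOn ℂ (fun s => G s * (n : ℂ) ^ s) {s | σ ≤ s.re} :=
    (hd.mono fun s hs => lt_of_lt_of_le hσ hs).mul
      (DifferentiableOn.const_cpow differentiableOn_id (Or.inl hn'))
  have h2 := tendsto_lineMean_sub (C := B * (n : ℝ) ^ x) hx hd' fun s hs hs' => by
    have hB' := hB s (lt_of_lt_of_le hσ hs)
    rw [norm_mul, norm_natCast_cpow hn]
    exact mul_le_mul hB' (Real.rpow_le_rpow_of_exponent_le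
      (by exact_mod_cast Nat.one_le_iff_ne_zero.mpr hn) hs') (by positivity)
      ((norm_nonneg _).trans hB')
  simpa using h1.sub h2

lemma lineMean_add {g h : ℂ → ℂ} {σ : ℝ} (hg : Continuous fun t : ℝ => g (σ + t * Complex.I))
    (hh : Continuous fun t : ℝ => h (σ + t * Complex.I)) (T : ℝ) :
    lineMean (fun s => g s + h s) σ T = lineMean g σ T + lineMean h σ T := by
  rw [lineMean, lineMean, lineMean, intervalIntegral.integral_add (hg.intervalIntegrable _ _)
    (hh.intervalIntegrable _ _), add_div]

lemma lineMean_sum {ι : Type*} (D : Finset ι) {h : ι → ℂ → ℂ} {σ : ℝ}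
    (hh : ∀ i ∈ D, Continuous fun t : ℝ => h i (σ + t * Complex.I)) (T : ℝ) :
    lineMean (fun s => ∑ i ∈ D, h i s) σ T = ∑ i ∈ D, lineMean (h i) σ T := by
  simp only [lineMean]
  rw [intervalIntegral.integral_finsetSum fun i hi => (hh i hi).intervalIntegrable _ _,
    Finset.sum_div]

lemma re_lineMean_nonpos {h : ℂ → ℂ} {σ T : ℝ} (hT : 0 < T)
    (hc : Continuous fun t : ℝ => h (σ + t * Complex.I))
    (hn : ∀ t : ℝ, (h (σ + t * Complex.I)).re ≤ 0) : (lineMean h σ T).re ≤ 0 := by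
  have h1 := Complex.reCLM.intervalIntegral_comp_comm
    (hc.intervalIntegrable (μ := MeasureTheory.volume) (-T) T)
  simp only [Complex.reCLM_apply] at h1
  have h2 : (2 * T : ℂ) = ((2 * T : ℝ) : ℂ) := by push_cast; rfl
  rw [lineMean, h2, Complex.div_ofReal_re, ← h1]
  refine div_nonpos_of_nonpos_of_nonneg ?_ (by linarith)
  have := intervalIntegral.integral_mono_on (a := -T) (b := T) (by linarith)
    ((Complex.continuous_re.comp hc).intervalIntegrable (μ := MeasureTheory.volume) _ _)
    (continuous_const.intervalIntegrable (μ := MeasureTheory.volume) (-T) T) fun t _ => hn t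
  simpa using this

/-! ### Mean-square inequality for Dirichlet polynomials -/

/-- The Dirichlet polynomial with coefficients `c` on the finite set `D`. -/
def dirichletPoly (D : Finset ℕ) (c : ℕ → ℂ) (s : ℂ) : ℂ := ∑ n ∈ D, c n * (n : ℂ) ^ (-s)

lemma differentiable_dirichletPoly {D : Finset ℕ} (hD : 0 ∉ D) (c : ℕ → ℂ) :
    Differentiable ℂ (dirichletPoly D c) := by
  unfold dirichletPoly
  refine Differentiable.fun_sum fun n hn => ?_
  have hn0 : (n : ℂ) ≠ 0 := by
    have : n ≠ 0 := fun h => hD (h ▸ hn)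
    exact_mod_cast this
  exact (differentiable_const _).mul (differentiable_id.neg.const_cpow (Or.inl hn0))

lemma norm_dirichletPoly_le {D : Finset ℕ} (hD : 0 ∉ D) (c : ℕ → ℂ)
    {δ : ℝ} {s : ℂ} (hs : s ∈ halfPlane δ) :
    ‖dirichletPoly D c s‖ ≤ ∑ n ∈ D, ‖c n‖ * (n : ℝ) ^ (-δ) := by
  refine norm_sum_le_of_le _ fun n hn => ?_
  have hn0 : n ≠ 0 := fun h => hD (h ▸ hn)
  rw [norm_mul, norm_natCast_cpow hn0]
  refine mul_le_mul_of_nonneg_left (Real.rpow_le_rpow_of_exponent_le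
    (by exact_mod_cast Nat.one_le_iff_ne_zero.mpr hn0) ?_) (norm_nonneg _)
  have : δ < s.re := hs
  simp [this.le]

lemma lseriesHasSum_dirichletPoly {D : Finset ℕ} (hD : 0 ∉ D) (c : ℕ → ℂ) (s : ℂ) :
    LSeriesHasSum (fun n => if n ∈ D then c n else 0) s (dirichletPoly D c s) := by
  have h := hasSum_sum_of_ne_finset_zero (s := D) (L := .unconditional ℕ)
    (f := LSeries.term (fun n => if n ∈ D then c n else 0) s) fun n hn => by
      simp [LSeries.term_def, hn]
  have e : ∑ n ∈ D, LSeries.term (fun n => if n ∈ D then c n else 0) s n =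
      dirichletPoly D c s := by
    refine Finset.sum_congr rfl fun n hn => ?_
    have hn0 : n ≠ 0 := fun h => hD (h ▸ hn)
    rw [LSeries.term_of_ne_zero hn0, if_pos hn, Complex.cpow_neg, div_eq_mul_inv]
  rwa [e] at h

/-- On the line Re s = σ the conjugate of n^(-s) is n^(-2σ) n^s. Pairing with a conjugated
polynomial thus becomes a finite combination of coefficient means. -/
lemma conj_dirichletPoly {D : Finset ℕ} (hD : 0 ∉ D) (c : ℕ → ℂ) (σ t : ℝ) :
    (starRingEnd ℂ) (dirichletPoly D c (σ + t * Complex.I)) =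
      ∑ n ∈ D, (starRingEnd ℂ) (c n) * ((n : ℝ) ^ (-(2 * σ)) : ℝ) *
        (n : ℂ) ^ (σ + t * Complex.I : ℂ) := by
  rw [dirichletPoly, map_sum]
  refine Finset.sum_congr rfl fun n hn => ?_
  have hn0 : n ≠ 0 := fun h => hD (h ▸ hn)
  have hn' : (n : ℂ) ≠ 0 := by exact_mod_cast hn0
  have h1 : (starRingEnd ℂ) ((n : ℂ) ^ (-(σ + t * Complex.I : ℂ))) =
      (n : ℂ) ^ ((starRingEnd ℂ) (-(σ + t * Complex.I : ℂ))) := by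
    rw [Complex.cpow_conj _ _ (by rw [Complex.natCast_arg]; exact Real.pi_pos.ne),
      Complex.conj_natCast]
  rw [map_mul, h1, mul_assoc, Complex.ofReal_cpow n.cast_nonneg, Complex.ofReal_natCast,
    ← Complex.cpow_add _ _ hn']
  congr 2
  simp
  ring

lemma tendsto_lineMean_mul_conj {D : Finset ℕ} (hD : 0 ∉ D) (c : ℕ → ℂ)
    {G : ℂ → ℂ} {δ B τ σ : ℝ} {b : ℕ → ℂ}
    (hd : DifferentiableOn ℂ G (halfPlane δ)) (hB : ∀ s ∈ halfPlane δ, ‖G s‖ ≤ B)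
    (hb : ∀ s : ℂ, τ < s.re → LSeriesHasSum b s (G s)) (hσ : δ < σ) :
    Tendsto (lineMean (fun s => G s * (starRingEnd ℂ) (dirichletPoly D c s)) σ) atTop
      (𝓝 (∑ n ∈ D, (starRingEnd ℂ) (c n) * ((n : ℝ) ^ (-(2 * σ)) : ℝ) * b n)) := by
  have hG : Continuous fun t : ℝ => G (σ + t * Complex.I) :=
    hd.continuousOn.comp_continuous (by fun_prop) fun t => by simpa [halfPlane] using hσ
  have e : lineMean (fun s => G s * (starRingEnd ℂ) (dirichletPoly D c s)) σ = fun T =>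
      ∑ n ∈ D, (starRingEnd ℂ) (c n) * ((n : ℝ) ^ (-(2 * σ)) : ℝ) *
        lineMean (fun s => G s * (n : ℂ) ^ s) σ T := by
    funext T
    simp only [← lineMean_const_mul]
    rw [← lineMean_sum D fun n hn => ?_]
    · simp only [lineMean]
      congr 2
      funext t
      rw [conj_dirichletPoly hD, Finset.mul_sum]
      exact Finset.sum_congr rfl fun n _ => by ring
    · have hn0 : n ≠ 0 := fun h => hD (h ▸ hn)
      exact continuous_const.mul (hG.mul (continuous_const.cpow (by fun_prop)
        fun _ => by simp [hn0]))
  rw [e]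
  refine tendsto_finsetSum _ fun n hn => Tendsto.const_mul _ ?_
  exact tendsto_lineMean_of_bounded hd hB hb hσ fun h => hD (h ▸ hn)

/-- Multiplication by a bounded function of norm at most `B` increases the square mean of a
Dirichlet polynomial by a factor of at most `B ^ 2`. -/
lemma sum_norm_sq_le_of_bounded {D : Finset ℕ} (hD : 0 ∉ D) (c : ℕ → ℂ)
    {F : ℂ → ℂ} {δ B τ σ : ℝ} {b : ℕ → ℂ}
    (hd : DifferentiableOn ℂ F (halfPlane δ)) (hB : ∀ s ∈ halfPlane δ, ‖F s‖ ≤ B)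
    (hb : ∀ s : ℂ, τ < s.re → LSeriesHasSum b s (F s * dirichletPoly D c s)) (hσ : δ < σ) :
    ∑ n ∈ D, ‖b n‖ ^ 2 * (n : ℝ) ^ (-(2 * σ)) ≤
      B ^ 2 * ∑ n ∈ D, ‖c n‖ ^ 2 * (n : ℝ) ^ (-(2 * σ)) := by
  have hline : ∀ t : ℝ, (σ + t * Complex.I : ℂ) ∈ halfPlane δ := fun t => by
    simpa [halfPlane] using hσ
  have hB0 : 0 ≤ B := (norm_nonneg _).trans (hB _ (hline 0))
  have hPd := fun c => (differentiable_dirichletPoly hD c).differentiableOn (s := halfPlane δ)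
  have hPb := fun (c : ℕ → ℂ) (s : ℂ) (hs : s ∈ halfPlane δ) => norm_dirichletPoly_le hD c hs
  have t1 := tendsto_lineMean_mul_conj hD b (hd.mul (hPd c)) (fun s hs => by
    rw [Pi.mul_apply, norm_mul]
    exact mul_le_mul (hB s hs) (hPb c s hs) (norm_nonneg _) hB0) hb hσ
  have t2 := fun c : ℕ → ℂ => tendsto_lineMean_mul_conj hD c (hPd c) (hPb c) (τ := 0)
    (fun s _ => lseriesHasSum_dirichletPoly hD c s) hσ
  have e2 : ∀ c : ℕ → ℂ, (∑ n ∈ D, (starRingEnd ℂ) (c n) * ((n : ℝ) ^ (-(2 * σ)) : ℝ) *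
      (if n ∈ D then c n else 0)) = ((∑ n ∈ D, ‖c n‖ ^ 2 * (n : ℝ) ^ (-(2 * σ)) : ℝ) : ℂ) := by
    intro c
    push_cast
    refine Finset.sum_congr rfl fun n hn => ?_
    rw [if_pos hn, ← Complex.conj_mul']
    ring
  have e1 : (∑ n ∈ D, (starRingEnd ℂ) (b n) * ((n : ℝ) ^ (-(2 * σ)) : ℝ) * b n) =
      ((∑ n ∈ D, ‖b n‖ ^ 2 * (n : ℝ) ^ (-(2 * σ)) : ℝ) : ℂ) := by
    rw [← e2 b]
    exact Finset.sum_congr rfl fun n hn => by rw [if_pos hn]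
  rw [e1] at t1
  simp only [e2] at t2
  set X := ∑ n ∈ D, ‖b n‖ ^ 2 * (n : ℝ) ^ (-(2 * σ))
  set Y := ∑ n ∈ D, ‖c n‖ ^ 2 * (n : ℝ) ^ (-(2 * σ))
  have hF : Continuous fun t : ℝ => F (σ + t * Complex.I) :=
    hd.continuousOn.comp_continuous (by fun_prop) hline
  have hP : ∀ c : ℕ → ℂ, Continuous fun t : ℝ => dirichletPoly D c (σ + t * Complex.I) :=
    fun c => (differentiable_dirichletPoly hD c).continuous.comp (by fun_prop)
  have hP' : ∀ c : ℕ → ℂ, Continuous fun t : ℝ =>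
      (starRingEnd ℂ) (dirichletPoly D c (σ + t * Complex.I)) :=
    fun c => Complex.continuous_conj.comp (hP c)
  -- With p and q the polynomials of c and b on D, the mean of 2 F p q̄ - |q|² - B²|p|² tends to 2X
  -- - X - B²Y. Its real part is pointwise nonpositive because 2B|p||q| ≤ B²|p|² + |q|², so X ≤ B²Y
  -- follows without a Parseval formula for the full product.
  have hlim := (((t1.const_mul 2).add ((t2 b).const_mul (-1))).add
    ((t2 c).const_mul (-(B : ℂ) ^ 2)))
  have hre := (Complex.continuous_re.tendsto _).comp hlim
  have hfin : ((2 * (X : ℂ) + -1 * (X : ℂ) + -(B : ℂ) ^ 2 * (Y : ℂ)).re) ≤ 0 := by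
    refine le_of_tendsto hre ?_
    filter_upwards [eventually_gt_atTop 0] with T hT
    have c1 : Continuous fun t : ℝ => 2 * ((F * dirichletPoly D c) (σ + t * Complex.I) *
        (starRingEnd ℂ) (dirichletPoly D b (σ + t * Complex.I))) :=
      continuous_const.mul ((hF.mul (hP c)).mul (hP' b))
    have c2 : Continuous fun t : ℝ => -1 * (dirichletPoly D b (σ + t * Complex.I) *
        (starRingEnd ℂ) (dirichletPoly D b (σ + t * Complex.I))) :=
      continuous_const.mul ((hP b).mul (hP' b))
    have c3 : Continuous fun t : ℝ => -(B : ℂ) ^ 2 * (dirichletPoly D c (σ + t * Complex.I) *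
        (starRingEnd ℂ) (dirichletPoly D c (σ + t * Complex.I))) :=
      continuous_const.mul ((hP c).mul (hP' c))
    simp only [Function.comp, ← lineMean_const_mul]
    rw [← lineMean_add c1 c2, ← lineMean_add (c1.add c2) c3]
    refine re_lineMean_nonpos hT ((c1.add c2).add c3) fun t => ?_
    have hFt := hB _ (hline t)
    rw [Pi.mul_apply]
    generalize F (σ + t * Complex.I) = u at *
    generalize dirichletPoly D c (σ + t * Complex.I) = p at *
    generalize dirichletPoly D b (σ + t * Complex.I) = q at *
    have h1 : (u * p * (starRingEnd ℂ) q).re ≤ ‖u * p‖ * ‖q‖ := by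
      have := Complex.re_le_norm (u * p * (starRingEnd ℂ) q)
      rwa [norm_mul, RCLike.norm_conj] at this
    have h2 : ‖u * p‖ ≤ B * ‖p‖ := by
      rw [norm_mul]; exact mul_le_mul_of_nonneg_right hFt (norm_nonneg _)
    have e3 : (2 * (u * p * (starRingEnd ℂ) q) + -1 * (q * (starRingEnd ℂ) q) +
        -(B : ℂ) ^ 2 * (p * (starRingEnd ℂ) p)).re =
        2 * (u * p * (starRingEnd ℂ) q).re - ‖q‖ ^ 2 - B ^ 2 * ‖p‖ ^ 2 := by
      rw [Complex.mul_conj' q, Complex.mul_conj' p]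
      have k1 : -(1 : ℂ) * (‖q‖ : ℂ) ^ 2 = ((-‖q‖ ^ 2 : ℝ) : ℂ) := by push_cast; ring
      have k2 : -(B : ℂ) ^ 2 * (‖p‖ : ℂ) ^ 2 = ((-(B ^ 2 * ‖p‖ ^ 2) : ℝ) : ℂ) := by
        push_cast; ring
      rw [k1, k2, Complex.add_re, Complex.add_re, Complex.ofReal_re, Complex.ofReal_re]
      have : (2 : ℂ) = ((2 : ℝ) : ℂ) := by norm_num
      rw [this, Complex.re_ofReal_mul]
      ring
    rw [e3]
    nlinarith [sq_nonneg (B * ‖p‖ - ‖q‖), norm_nonneg q, norm_nonneg p,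
      mul_le_mul_of_nonneg_right h2 (norm_nonneg q)]
  have e4 : (2 * (X : ℂ) + -1 * (X : ℂ) + -(B : ℂ) ^ 2 * (Y : ℂ)) =
      ((X - B ^ 2 * Y : ℝ) : ℂ) := by push_cast; ring
  rw [e4, Complex.ofReal_re] at hfin
  linarith

/-- The version on the boundary line. -/
lemma sum_norm_sq_le_of_bounded' {D : Finset ℕ} (hD : 0 ∉ D) (c : ℕ → ℂ)
    {F : ℂ → ℂ} {δ B τ : ℝ} {b : ℕ → ℂ}
    (hd : DifferentiableOn ℂ F (halfPlane δ)) (hB : ∀ s ∈ halfPlane δ, ‖F s‖ ≤ B)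
    (hb : ∀ s : ℂ, τ < s.re → LSeriesHasSum b s (F s * dirichletPoly D c s)) :
    ∑ n ∈ D, ‖b n‖ ^ 2 * (n : ℝ) ^ (-(2 * δ)) ≤
      B ^ 2 * ∑ n ∈ D, ‖c n‖ ^ 2 * (n : ℝ) ^ (-(2 * δ)) := by
  have hlim : ∀ b : ℕ → ℂ, Tendsto (fun σ : ℝ => ∑ n ∈ D, ‖b n‖ ^ 2 * (n : ℝ) ^ (-(2 * σ)))
      (𝓝[>] δ) (𝓝 (∑ n ∈ D, ‖b n‖ ^ 2 * (n : ℝ) ^ (-(2 * δ)))) := fun b => by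
    refine Tendsto.mono_left ?_ nhdsWithin_le_nhds
    refine tendsto_finsetSum _ fun n hn => Tendsto.const_mul _ ?_
    have hn0 : (n : ℝ) ≠ 0 := by
      have : n ≠ 0 := fun h => hD (h ▸ hn)
      exact_mod_cast this
    exact (Continuous.rpow continuous_const (by fun_prop) fun _ => Or.inl hn0).tendsto δ
  refine le_of_tendsto_of_tendsto (hlim b) ((hlim c).const_mul (B ^ 2)) ?_
  filter_upwards [self_mem_nhdsWithin] with σ hσ
  exact sum_norm_sq_le_of_bounded hD c hd hB hb hσ

/-! ### From the weights n^(-2δ) to the weights w -/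

lemma sum_divisors_mul_of_coprime {A B : ℕ} (h : A.Coprime B) (g : ℕ → ℝ) :
    ∑ n ∈ (A * B).divisors, g n = ∑ x ∈ A.divisors, ∑ y ∈ B.divisors, g (x * y) := by
  rw [← Finset.sum_product', Nat.divisors_mul, Finset.mul_def,
    Finset.sum_image (by simpa using h.mul_injOn_divisors)]

/-- Summation by parts along the divisibility order: a multiplicative weight that decreases along
the powers of each prime preserves nonnegativity of sums over divisors. -/
lemma sum_divisors_weight_nonneg {v : ℕ → ℝ} (hv : ∀ n, 0 ≤ v n)
    (hmul : ∀ m n : ℕ, m.Coprime n → v (m * n) = v m * v n)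
    (hdec : ∀ p : ℕ, p.Prime → ∀ k : ℕ, v (p ^ (k + 1)) ≤ v (p ^ k)) (M : ℕ) (c : ℕ → ℝ)
    (hc : ∀ m, m ∣ M → 0 ≤ ∑ n ∈ m.divisors, c n) : 0 ≤ ∑ n ∈ M.divisors, v n * c n := by
  induction M using Nat.recOnPrimeCoprime generalizing c with
  | zero => simp
  | prime_pow p K hp =>
    rw [Nat.sum_divisors_prime_pow hp]
    have hs : ∀ k ≤ K, 0 ≤ ∑ j ∈ Finset.range (k + 1), c (p ^ j) := fun k hk => by
      rw [← Nat.sum_divisors_prime_pow hp]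
      exact hc _ (pow_dvd_pow p hk)
    -- Abel summation as an invariant: lowering the weight from v(p^k) to v(p^(k+1)) on a
    -- nonnegative partial sum can only decrease it.
    have key : ∀ k ≤ K, v (p ^ k) * ∑ j ∈ Finset.range (k + 1), c (p ^ j) ≤
        ∑ j ∈ Finset.range (k + 1), v (p ^ j) * c (p ^ j) := fun k => by
      induction k with
      | zero => simp
      | succ k ih =>
        intro hk
        rw [Finset.sum_range_succ, Finset.sum_range_succ (n := k + 1), mul_add]
        have h1 := ih (by omega)
        have h2 := mul_le_mul_of_nonneg_right (hdec p hp k) (hs k (by omega))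
        linarith
    exact (mul_nonneg (hv _) (hs K le_rfl)).trans (key K le_rfl)
  | coprime A B hA hB hAB ihA ihB =>
    rw [sum_divisors_mul_of_coprime hAB]
    have e : ∀ x ∈ A.divisors, ∑ y ∈ B.divisors, v (x * y) * c (x * y) =
        v x * ∑ y ∈ B.divisors, v y * c (x * y) := fun x hx => by
      rw [Finset.mul_sum]
      refine Finset.sum_congr rfl fun y hy => ?_
      rw [hmul x y ((hAB.coprime_dvd_left (Nat.dvd_of_mem_divisors hx)).coprime_dvd_right
        (Nat.dvd_of_mem_divisors hy)), mul_assoc]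
    rw [Finset.sum_congr rfl e]
    -- The hypothesis for A is applied to x ↦ ∑ v(y) c(xy) over y ∣ B. Its divisor sums, after
    -- exchanging summations, are the weighted sums covered by the hypothesis for B.
    refine ihA _ fun m hm => ?_
    rw [Finset.sum_comm]
    simp only [← Finset.mul_sum]
    refine ihB _ fun l hl => ?_
    rw [Finset.sum_comm,
      ← sum_divisors_mul_of_coprime ((hAB.coprime_dvd_left hm).coprime_dvd_right hl)]
    exact hc _ (mul_dvd_mul hm hl)

/-- Multiplication by a bounded Dirichlet series is bounded on the coefficients indexed by the
divisors of a fixed integer. -/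
lemma sum_divisors_mul_norm_sq_le {F : ℂ → ℂ} {δ B τ : ℝ} {a : ArithmeticFunction ℂ}
    (hd : DifferentiableOn ℂ F (halfPlane δ)) (hB : ∀ s ∈ halfPlane δ, ‖F s‖ ≤ B)
    (ha : ∀ s : ℂ, τ < s.re → LSeriesHasSum a s (F s)) (f : ArithmeticFunction ℂ) (m : ℕ) :
    ∑ n ∈ m.divisors, ‖(a * f) n‖ ^ 2 * (n : ℝ) ^ (-(2 * δ)) ≤
      B ^ 2 * ∑ n ∈ m.divisors, ‖f n‖ ^ 2 * (n : ℝ) ^ (-(2 * δ)) := by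
  have hD : 0 ∉ m.divisors := by simp
  have h := sum_norm_sq_le_of_bounded' hD f hd hB fun s hs =>
    (ha s hs).convolution (lseriesHasSum_dirichletPoly hD f s)
  refine (Finset.sum_congr rfl fun n hn => ?_).trans_le h
  congr 3
  rw [ArithmeticFunction.mul_apply, LSeries.convolution_def]
  refine Finset.sum_congr rfl fun x hx => ?_
  obtain ⟨hx1, hx2⟩ := Nat.mem_divisorsAntidiagonal.mp hx
  -- Every divisor of n ∣ m divides m, so cutting f off outside the divisors of m leaves the
  -- coefficient at n unchanged.
  rw [if_pos]
  exact Nat.divisors_subset_of_dvd (Nat.mem_divisors.mp hn).2 (Nat.dvd_of_mem_divisors hn)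
    (Nat.mem_divisors.mpr ⟨⟨x.1, by rw [mul_comm, hx1]⟩, hx2⟩)

/-- A bounded Dirichlet series multiplies the weighted space into itself, with norm at most the
supremum norm. -/
lemma convolution_mem_space {w : ArithmeticFunction ℝ} {hw : ∀ n, n ≠ 0 → 0 < w n} {δ : ℝ}
    (hmul : w.IsMultiplicative)
    (hdec : ∀ p : ℕ, p.Prime → ∀ k : ℕ, 1 ≤ k →
      w (p ^ k) ≤ (p : ℝ) ^ (-(2 * δ)) * w (p ^ (k - 1)))
    {F : ℂ → ℂ} {B τ : ℝ} {a : ArithmeticFunction ℂ}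
    (hd : DifferentiableOn ℂ F (halfPlane δ)) (hB : ∀ s ∈ halfPlane δ, ‖F s‖ ≤ B)
    (ha : ∀ s : ℂ, τ < s.re → LSeriesHasSum a s (F s)) (f : space w hw) :
    ∃ h : a * f.1 ∈ space w hw, ‖(⟨a * f.1, h⟩ : space w hw)‖ ≤ B * ‖f‖ := by
  have hw0 : ∀ n, 0 ≤ w n := fun n => by
    rcases eq_or_ne n 0 with rfl | h
    · simp
    · exact (hw n h).le
  have hB0 : 0 ≤ B := (norm_nonneg _).trans (hB (δ + 1 : ℝ) (by simp [halfPlane]))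
  have hdiv : ∀ M : ℕ, ∑ n ∈ M.divisors, ‖(a * f.1) n‖ ^ 2 * w n ≤
      B ^ 2 * ∑ n ∈ M.divisors, ‖f.1 n‖ ^ 2 * w n := fun M => by
    -- The factor n^(2δ) turns condition 4 into monotonicity along prime powers and cancels against
    -- n^(-2δ) in the sequence being summed.
    have h := sum_divisors_weight_nonneg (v := fun n => w n * (n : ℝ) ^ (2 * δ))
      (fun n => mul_nonneg (hw0 n) (by positivity))
      (fun m n hmn => by
        rw [hmul.map_mul_of_coprime hmn, Nat.cast_mul,
          Real.mul_rpow m.cast_nonneg n.cast_nonneg]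
        ring)
      (fun p hp k => by
        have hp0 : (0 : ℝ) < p := by exact_mod_cast hp.pos
        have h1 := hdec p hp (k + 1) (by omega)
        rw [Nat.add_sub_cancel] at h1
        have h2 : (p : ℝ) ^ (-(2 * δ)) * ((p ^ (k + 1) : ℕ) : ℝ) ^ (2 * δ) =
            ((p ^ k : ℕ) : ℝ) ^ (2 * δ) := by
          rw [pow_succ, Nat.cast_mul, Real.mul_rpow (by positivity) hp0.le, mul_comm, mul_assoc,
            ← Real.rpow_add hp0]
          simp
        calc w (p ^ (k + 1)) * ((p ^ (k + 1) : ℕ) : ℝ) ^ (2 * δ)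
            ≤ (p : ℝ) ^ (-(2 * δ)) * w (p ^ k) * ((p ^ (k + 1) : ℕ) : ℝ) ^ (2 * δ) :=
              mul_le_mul_of_nonneg_right h1 (by positivity)
          _ = w (p ^ k) * ((p ^ k : ℕ) : ℝ) ^ (2 * δ) := by rw [← h2]; ring)
      M (fun n => B ^ 2 * (‖f.1 n‖ ^ 2 * (n : ℝ) ^ (-(2 * δ))) -
        ‖(a * f.1) n‖ ^ 2 * (n : ℝ) ^ (-(2 * δ)))
      (fun m _ => by
        rw [Finset.sum_sub_distrib, ← Finset.mul_sum, sub_nonneg]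
        exact sum_divisors_mul_norm_sq_le hd hB ha f.1 m)
    rw [← sub_nonneg, Finset.mul_sum, ← Finset.sum_sub_distrib]
    refine h.trans_eq (Finset.sum_congr rfl fun n hn => ?_)
    have hn0 : (0 : ℝ) < n := by exact_mod_cast Nat.pos_of_mem_divisors hn
    have h3 : (n : ℝ) ^ (2 * δ) * (n : ℝ) ^ (-(2 * δ)) = 1 := by
      rw [← Real.rpow_add hn0]; simp
    linear_combination (w n * (B ^ 2 * ‖f.1 n‖ ^ 2 - ‖(a * f.1) n‖ ^ 2)) * h3
  have hf : Summable fun n : ℕ => ‖f.1 n‖ ^ 2 * w n := f.2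
  have hterm : ∀ g : ArithmeticFunction ℂ, ∀ n, 0 ≤ ‖g n‖ ^ 2 * w n := fun g n =>
    mul_nonneg (by positivity) (hw0 n)
  have hfin : ∀ u : Finset ℕ, ∑ n ∈ u, ‖(a * f.1) n‖ ^ 2 * w n ≤ B ^ 2 * ‖f‖ ^ 2 := fun u => by
    -- All nonzero elements of u divide N!, and the index 0 contributes nothing.
    set N := u.sup id
    have hsub : u.erase 0 ⊆ (N.factorial).divisors := fun n hn => by
      obtain ⟨hn0, hnu⟩ := Finset.mem_erase.mp hn
      exact Nat.mem_divisors.mpr ⟨Nat.dvd_factorial (Nat.pos_of_ne_zero hn0)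
        (Finset.le_sup (f := id) hnu), N.factorial_ne_zero⟩
    calc ∑ n ∈ u, ‖(a * f.1) n‖ ^ 2 * w n = ∑ n ∈ u.erase 0, ‖(a * f.1) n‖ ^ 2 * w n :=
          (Finset.sum_erase _ (by simp)).symm
      _ ≤ ∑ n ∈ (N.factorial).divisors, ‖(a * f.1) n‖ ^ 2 * w n :=
          Finset.sum_le_sum_of_subset_of_nonneg hsub fun n _ _ => hterm _ n
      _ ≤ _ := hdiv _
      _ ≤ _ := by
          rw [norm_sq_eq]
          exact mul_le_mul_of_nonneg_left (hf.sum_le_tsum _ fun n _ => hterm _ n) (sq_nonneg B)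
  have hsum : Summable fun n : ℕ => ‖(a * f.1) n‖ ^ 2 * w n :=
    summable_of_sum_le (hterm _) hfin
  refine ⟨hsum, ?_⟩
  refine (sq_le_sq₀ (norm_nonneg _) (mul_nonneg hB0 (norm_nonneg _))).mp ?_
  rw [norm_sq_eq, mul_pow]
  exact hsum.tsum_le_of_sum_le hfin

/-! ### Limits of bounded holomorphic functions -/

lemma isOpen_halfPlane (δ : ℝ) : IsOpen (halfPlane δ) :=
  isOpen_lt continuous_const Complex.continuous_re

/-- A uniformly bounded sequence of holomorphic functions on a half-plane that converges uniformly
on a smaller half-plane converges locally uniformly on the whole half-plane. -/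
lemma exists_bounded_limit {δ σ₁ B : ℝ} (hσ : δ < σ₁) {φ : ℕ → ℂ → ℂ}
    (hd : ∀ N, DifferentiableOn ℂ (φ N) (halfPlane δ))
    (hB : ∀ N, ∀ s ∈ halfPlane δ, ‖φ N s‖ ≤ B) {r : ℕ → ℝ} (hr : Tendsto r atTop (𝓝 0))
    (hφ : ∀ N M s, N ≤ M → σ₁ ≤ s.re → ‖φ N s - φ M s‖ ≤ r N) :
    ∃ F : ℂ → ℂ, DifferentiableOn ℂ F (halfPlane δ) ∧ (∀ s ∈ halfPlane δ, ‖F s‖ ≤ B) ∧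
      ∀ s ∈ halfPlane δ, Tendsto (fun N => φ N s) atTop (𝓝 (F s)) := by
  have hB0 : 0 ≤ B := (norm_nonneg _).trans (hB 0 (δ + 1 : ℝ) (by simp [halfPlane]))
  have hcauchy : ∀ σ₀, δ < σ₀ → UniformCauchySeqOn φ atTop (halfPlane σ₀) := fun σ₀ hσ₀ => by
    wlog h01 : σ₀ < σ₁ generalizing σ₀
    · obtain ⟨σ', h1, h2⟩ := exists_between hσ
      exact (this σ' h1 h2).mono fun s (hs : σ₀ < s.re) =>
        show σ' < s.re from by linarith
    obtain ⟨l, hl1, hl2⟩ := exists_between hσ₀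
    have hlu : l < σ₁ := hl2.trans h01
    -- The three lines exponent at Re s = σ₀ in the strip from l to σ₁. To its right the exponent is
    -- larger, which for b < 1 only improves the bound.
    set θ₀ := (σ₀ - l) / (σ₁ - l)
    have hθ₀ : 0 < θ₀ := div_pos (by linarith) (by linarith)
    rw [Metric.uniformCauchySeqOn_iff]
    intro ε hε
    -- Differences are at most 2B; the extra 1 makes the base at least 1, so its power with exponent
    -- 1 - θ is at most the base itself.
    have hlim : Tendsto (fun b : ℝ => (2 * B + 1) * b ^ θ₀) (𝓝[>] 0) (𝓝 0) := by
      have h1 := (Real.continuousAt_rpow_const 0 θ₀ (Or.inr hθ₀.le)).tendsto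
      rw [Real.zero_rpow hθ₀.ne'] at h1
      simpa using (h1.mono_left nhdsWithin_le_nhds).const_mul (2 * B + 1)
    obtain ⟨b, hb1, hb2, hb3⟩ := ((hlim.eventually (gt_mem_nhds hε)).and
      (((gt_mem_nhds (lt_min one_pos hε)).filter_mono nhdsWithin_le_nhds).and
        self_mem_nhdsWithin)).exists
    have hb0 : 0 < b := hb3
    have hbε : b < ε := hb2.trans_le (min_le_right _ _)
    have hb11 : b < 1 := hb2.trans_le (min_le_left _ _)
    obtain ⟨N, hN⟩ := (hr.eventually (gt_mem_nhds (half_pos hb0))).exists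
    have hright : ∀ m ≥ N, ∀ n ≥ N, ∀ s : ℂ, σ₁ ≤ s.re → ‖φ m s - φ n s‖ ≤ b :=
      fun m hm n hn s hs => by
        have h1 := hφ N m s hm hs
        have h2 := hφ N n s hn hs
        rw [norm_sub_rev] at h1
        have := norm_sub_le_norm_sub_add_norm_sub (φ m s) (φ N s) (φ n s)
        linarith
    refine ⟨N, fun m hm n hn s hs => ?_⟩
    rw [dist_eq_norm]
    rcases le_or_gt σ₁ s.re with h | h
    · exact (hright m hm n hn s h).trans_lt hbε
    have hs' : σ₀ < s.re := hs
    have hbd : ∀ z : ℂ, l ≤ z.re → ‖φ m z - φ n z‖ ≤ 2 * B + 1 := fun z hz => by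
      have hz' : z ∈ halfPlane δ := hl1.trans_le hz
      have := norm_sub_le (φ m z) (φ n z)
      linarith [hB m z hz', hB n z hz']
    have hdiff : DifferentiableOn ℂ (fun z => φ m z - φ n z) (halfPlane δ) := (hd m).sub (hd n)
    have h3 := Complex.HadamardThreeLines.norm_le_interp_of_mem_verticalClosedStrip'
      (f := fun z => φ m z - φ n z) (a := 2 * B + 1) (b := b) hlu
      (z := s) ⟨by linarith, h.le⟩ (by
        refine DifferentiableOn.diffContOnCl (hdiff.mono ?_)
        refine (closure_minimal (t := {z : ℂ | l ≤ z.re}) (fun z hz => hz.1.le)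
          (isClosed_le continuous_const Complex.continuous_re)).trans fun z hz => ?_
        exact hl1.trans_le hz)
      ⟨2 * B + 1, by
        rintro _ ⟨z, hz, rfl⟩
        exact hbd z hz.1⟩
      (fun z hz => hbd z (le_of_eq (Eq.symm hz)))
      (fun z hz => hright m hm n hn z (le_of_eq (Eq.symm hz)))
    set θ := (s.re - l) / (σ₁ - l)
    have hθθ : θ₀ ≤ θ := div_le_div_of_nonneg_right (by linarith) (by linarith)
    refine h3.trans_lt (lt_of_le_of_lt (mul_le_mul ?_ ?_ (by positivity) (by positivity)) hb1)
    · exact (Real.rpow_le_rpow_of_exponent_le (by linarith) (by linarith)).trans_eq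
        (Real.rpow_one _)
    · exact Real.rpow_le_rpow_of_exponent_ge hb0 hb11.le hθθ
  have hex : ∀ s ∈ halfPlane δ, ∃ y, Tendsto (fun N => φ N s) atTop (𝓝 y) := fun s hs => by
    obtain ⟨σ₀, h1, h2⟩ := exists_between (show δ < s.re from hs)
    exact cauchySeq_tendsto_of_complete ((hcauchy σ₀ h1).cauchySeq h2)
  choose! F hF using hex
  refine ⟨F, fun s hs => ?_, fun s hs => ?_, hF⟩
  · obtain ⟨σ₀, h1, h2⟩ := exists_between (show δ < s.re from hs)
    have hsub : halfPlane σ₀ ⊆ halfPlane δ := fun z hz => h1.trans hz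
    have h3 := ((hcauchy σ₀ h1).tendstoUniformlyOn_of_tendsto
      fun z hz => hF z (hsub hz)).tendstoLocallyUniformlyOn.differentiableOn
      (Eventually.of_forall fun N => (hd N).mono hsub) (isOpen_halfPlane σ₀)
    exact (h3.differentiableAt ((isOpen_halfPlane σ₀).mem_nhds h2)).differentiableWithinAt
  · exact le_of_tendsto (hF s hs).norm (Eventually.of_forall fun N => hB N s hs)

/-- Taking k-th roots removes the constant C as k grows. -/
lemma le_of_pow_le_mul_pow {x y C : ℝ} (hy : 0 ≤ y) (h : ∀ k : ℕ, x ^ k ≤ C * y ^ k) :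
    x ≤ y := by
  by_contra! hxy
  rcases hy.eq_or_lt with rfl | hy
  · have := h 1
    simp only [pow_one, mul_zero] at this
    linarith
  obtain ⟨k, hk⟩ := pow_unbounded_of_one_lt C ((one_lt_div hy).mpr hxy)
  rw [div_pow, lt_div_iff₀ (by positivity)] at hk
  exact absurd (h k) (not_le.mpr hk)

/-! ### Operators of multiplication -/

variable {w : ArithmeticFunction ℝ} {hw : ∀ n, n ≠ 0 → 0 < w n}

/-- The constant series `1`, as an element of the space. -/
def unitSeries (w : ArithmeticFunction ℝ) (hw : ∀ n, n ≠ 0 → 0 < w n) : space w hw :=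
  ⟨1, summable_of_ne_finset_zero (s := {1}) fun n hn => by
    simp [Finset.mem_singleton.not.mp hn]⟩

lemma lseries_unitSeries (s : ℂ) : LSeries (unitSeries w hw).1 s = 1 := by
  have : ((unitSeries w hw).1 : ℕ → ℂ) = LSeries.delta := ArithmeticFunction.one_eq_delta
  rw [this, LSeries_delta, Pi.one_apply]

lemma abscissa_le {σ₀ : ℝ} (hs : SummableWeight w σ₀) (f : space w hw) :
    LSeries.abscissaOfAbsConv f.1 ≤ σ₀ :=
  LSeries.abscissaOfAbsConv_le_of_forall_lt_LSeriesSummable fun _ hy =>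
    lseriesSummable hs f (by simpa [halfPlane] using hy)

lemma eq_of_lseries_eqOn {σ₀ : ℝ} {f g : ArithmeticFunction ℂ}
    (hf : LSeries.abscissaOfAbsConv f < ⊤) (hg : LSeries.abscissaOfAbsConv g < ⊤)
    (h : ∀ s ∈ halfPlane σ₀, LSeries f s = LSeries g s) : f = g := by
  ext n
  rcases eq_or_ne n 0 with rfl | hn
  · simp
  refine LSeries.eq_of_LSeries_eventually_eq hf hg ?_ hn
  filter_upwards [eventually_gt_atTop σ₀] with x hx
  exact h x (by simpa [halfPlane] using hx)

/-- If `φ f` and `φ` are represented by series in the space, the former is the Dirichlet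
convolution of the latter with `f`. -/
lemma eq_convolution_of_lseries {σ₀ : ℝ} (hs : SummableWeight w σ₀) {φ : halfPlane σ₀ → ℂ}
    {a f g : space w hw} (ha : ∀ s : halfPlane σ₀, LSeries a.1 s = φ s)
    (hg : ∀ s : halfPlane σ₀, LSeries g.1 s = φ s * LSeries f.1 s) : g.1 = a.1 * f.1 := by
  have hsum : ∀ s ∈ halfPlane σ₀, LSeriesSummable ⇑(a.1 * f.1) s := fun s h =>
    ArithmeticFunction.LSeriesSummable_mul (lseriesSummable hs a h) (lseriesSummable hs f h)
  refine eq_of_lseries_eqOn (σ₀ := σ₀) ((abscissa_le hs g).trans_lt (EReal.coe_lt_top _)) ?_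
    fun s h => ?_
  · refine lt_of_le_of_lt (b := (σ₀ : EReal))
      (LSeries.abscissaOfAbsConv_le_of_forall_lt_LSeriesSummable fun y hy => ?_)
      (EReal.coe_lt_top _)
    exact hsum y (by simpa [halfPlane] using hy)
  · rw [hg ⟨s, h⟩, ← ha ⟨s, h⟩]
    exact (ArithmeticFunction.LSeries_mul' (lseriesSummable hs a h)
      (lseriesSummable hs f h)).symm

lemma IsMultiplicationBy.lseries_unit {σ₀ : ℝ} {T : space w hw →L[ℂ] space w hw}
    {φ : halfPlane σ₀ → ℂ} (h : IsMultiplicationBy w hw σ₀ T φ) (s : halfPlane σ₀) :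
    LSeries (T (unitSeries w hw)).1 s = φ s := by
  rw [h, lseries_unitSeries, mul_one]

lemma norm_apply_sq_le (f : space w hw) (n : ℕ) : ‖f.1 n‖ ^ 2 * w n ≤ ‖f‖ ^ 2 := by
  rw [norm_sq_eq]
  refine Summable.le_tsum (show Summable fun n : ℕ => ‖f.1 n‖ ^ 2 * w n from f.2) n fun m _ => ?_
  rcases eq_or_ne m 0 with rfl | hm
  · simp
  · exact mul_nonneg (by positivity) (hw m hm).le

/-- Positivity of w n bounds the n-th coefficient by the norm. This identifies limits in the closed
graph argument. -/
lemma continuous_coeff (n : ℕ) : Continuous fun f : space w hw => f.1 n := by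
  rcases eq_or_ne n 0 with rfl | hn
  · simpa using continuous_const
  have hwn := hw n hn
  let L : space w hw →ₗ[ℂ] ℂ :=
    { toFun := fun f => f.1 n
      map_add' := fun _ _ => rfl
      map_smul' := fun _ _ => rfl }
  refine (L.mkContinuous (√(w n))⁻¹ fun f => ?_).continuous
  have h := norm_apply_sq_le f n
  have h2 : (‖f.1 n‖ * √(w n)) ^ 2 ≤ ‖f‖ ^ 2 := by rwa [mul_pow, Real.sq_sqrt hwn.le]
  have h3 := (sq_le_sq₀ (by positivity) (norm_nonneg _)).mp h2
  rw [inv_mul_eq_div, le_div_iff₀ (Real.sqrt_pos.mpr hwn)]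
  exact h3

/-- Multipliers act by bounded operators (closed graph theorem). -/
lemma IsMultiplier.exists_operator {σ₀ : ℝ} (hs : SummableWeight w σ₀) {φ : halfPlane σ₀ → ℂ}
    (hφ : IsMultiplier w hw σ₀ φ) :
    ∃ T : space w hw →L[ℂ] space w hw, IsMultiplicationBy w hw σ₀ T φ := by
  choose S hS using hφ
  set a := S (unitSeries w hw)
  have ha : ∀ s : halfPlane σ₀, LSeries a.1 s = φ s := fun s => by
    rw [hS, lseries_unitSeries, mul_one]
  -- The products were merely chosen one f at a time; being convolutions with a, they depend
  -- linearly on f.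
  have hSa : ∀ f, (S f).1 = a.1 * f.1 := fun f => eq_convolution_of_lseries hs ha (hS f)
  let L : space w hw →ₗ[ℂ] space w hw :=
    { toFun := S
      map_add' := fun f g => Subtype.ext <| by
        change (S (f + g)).1 = (S f).1 + (S g).1
        rw [hSa (f + g), hSa f, hSa g, ← mul_add]
        rfl
      map_smul' := fun c f => Subtype.ext <| by
        change (S (c • f)).1 = c • (S f).1
        rw [hSa (c • f), hSa f]
        ext n
        change (a.1 * (c • f.1)) n = c * (a.1 * f.1) n
        rw [ArithmeticFunction.mul_apply, ArithmeticFunction.mul_apply, Finset.mul_sum]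
        refine Finset.sum_congr rfl fun x _ => ?_
        change a.1 x.1 * (c * f.1 x.2) = _
        ring }
  have hL : Continuous L := by
    refine L.continuous_of_seq_closed_graph fun u x y hu hy => Subtype.ext ?_
    ext n
    refine tendsto_nhds_unique (((continuous_coeff n).tendsto y).comp hy) ?_
    change Tendsto (fun k => (S (u k)).1 n) atTop (𝓝 ((S x).1 n))
    -- Each coefficient of a convolution involves finitely many coefficients of u k, so it passes to
    -- the limit.
    simp only [hSa _, ArithmeticFunction.mul_apply]
    exact tendsto_finsetSum _ fun z _ =>
      (((continuous_coeff z.2).tendsto x).comp hu).const_mul _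
  exact ⟨⟨L, hL⟩, hS⟩

/-! ### Restriction to the words generated by the first primes -/

/-- The part of a series supported on the words generated by the first `N` primes. -/
def restrictWords (N : ℕ) (f : ArithmeticFunction ℂ) : ArithmeticFunction ℂ :=
  ⟨fun n => (primeWords N).indicator f n, by simp [Set.indicator]⟩

lemma restrictWords_apply (N : ℕ) (f : ArithmeticFunction ℂ) (n : ℕ) :
    restrictWords N f n = (primeWords N).indicator f n := rfl

/-- The words are closed under products and under divisors, so a factorization of n lies in the
words exactly when n does. -/
lemma restrictWords_mul (N : ℕ) (a f : ArithmeticFunction ℂ) :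
    restrictWords N (a * f) = restrictWords N a * restrictWords N f := by
  ext n
  rw [restrictWords_apply, ArithmeticFunction.mul_apply]
  by_cases hn : n ∈ primeWords N
  · rw [Set.indicator_of_mem hn, ArithmeticFunction.mul_apply]
    refine Finset.sum_congr rfl fun x hx => ?_
    have h := (Nat.mem_divisorsAntidiagonal.mp hx).1
    rw [restrictWords_apply, restrictWords_apply, Set.indicator_of_mem, Set.indicator_of_mem]
    · exact Nat.mem_factoredNumbers_of_dvd hn ⟨x.1, by rw [mul_comm, h]⟩
    · exact Nat.mem_factoredNumbers_of_dvd hn ⟨x.2, h.symm⟩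
  · rw [Set.indicator_of_notMem hn]
    refine (Finset.sum_eq_zero fun x hx => ?_).symm
    have h := (Nat.mem_divisorsAntidiagonal.mp hx).1
    by_cases h1 : x.1 ∈ primeWords N
    · have h2 : x.2 ∉ primeWords N := fun h2 => hn (h ▸ Nat.mul_mem_factoredNumbers h1 h2)
      rw [restrictWords_apply N f, Set.indicator_of_notMem h2, mul_zero]
    · rw [restrictWords_apply N a, Set.indicator_of_notMem h1, zero_mul]

lemma primeWords_mono {N M : ℕ} (h : N ≤ M) : primeWords N ⊆ primeWords M :=
  Nat.factoredNumbers_mono (Finset.image_subset_image (Finset.range_mono h))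

/-- A prime p has at most p primes below it, so its index is at most p ≤ n < N. -/
lemma mem_primeWords_of_lt {n N : ℕ} (hn : n ≠ 0) (h : n < N) : n ∈ primeWords N := by
  refine Nat.mem_factoredNumbers.mpr ⟨hn, fun p hp => ?_⟩
  have hpp := Nat.prime_of_mem_primeFactorsList hp
  refine Finset.mem_image.mpr ⟨Nat.count Nat.Prime p, Finset.mem_range.mpr ?_, Nat.nth_count hpp⟩
  exact ((Nat.count_le (p := Nat.Prime)).trans (Nat.le_of_mem_primeFactorsList hp)).trans_lt h

lemma norm_term_restrictWords_le (N : ℕ) (f : ArithmeticFunction ℂ) (s : ℂ) (n : ℕ) :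
    ‖LSeries.term (restrictWords N f) s n‖ ≤ ‖LSeries.term f s n‖ := by
  rw [LSeries.norm_term_eq, LSeries.norm_term_eq]
  split_ifs with h
  · exact le_rfl
  · exact div_le_div_of_nonneg_right (norm_indicator_le_norm_self _ _) (by positivity)

/-- Point evaluations of the restricted series are bounded where the weights restricted to the
words are summable. -/
lemma exists_norm_lseries_restrictWords_le {N : ℕ} {s : ℂ}
    (h : Summable fun n : primeWords N => (w (n : ℕ))⁻¹ * ((n : ℕ) : ℝ) ^ (-(2 * s.re))) :
    ∃ C : ℝ, ∀ f : space w hw, LSeriesSummable (restrictWords N f.1) s ∧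
      ‖LSeries (restrictWords N f.1) s‖ ≤ C * ‖f‖ := by
  have hw0 : ∀ n, 0 ≤ w n := fun n => by
    rcases eq_or_ne n 0 with rfl | h
    · simp
    · exact (hw n h).le
  set g : ℕ → ℝ := (primeWords N).indicator fun n => (w n)⁻¹ * (n : ℝ) ^ (-(2 * s.re))
  have hg0 : ∀ n, 0 ≤ g n := fun n =>
    Set.indicator_nonneg (fun n _ => mul_nonneg (inv_nonneg.mpr (hw0 n)) (by positivity)) n
  have hg : Summable g := summable_subtype_iff_indicator.mp h
  -- The Cauchy–Schwarz constant, obtained by splitting each term as (|f n| √(w n)) · √(g n).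
  refine ⟨√(∑' n, g n), fun f => ?_⟩
  have hf : Summable fun n : ℕ => ‖f.1 n‖ ^ 2 * w n := f.2
  have hterm : ∀ n, ‖LSeries.term (restrictWords N f.1) s n‖ ≤ (‖f.1 n‖ * √(w n)) * √(g n) :=
    fun n => by
      rcases eq_or_ne n 0 with rfl | hn
      · simp
      rw [LSeries.norm_term_eq, if_neg hn, restrictWords_apply]
      by_cases hnN : n ∈ primeWords N
      · have hn0 : (0 : ℝ) < n := by positivity
        have e : (n : ℝ) ^ (-(2 * s.re)) = (((n : ℝ) ^ s.re)⁻¹) ^ 2 := by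
          rw [← Real.rpow_neg hn0.le, ← Real.rpow_natCast, ← Real.rpow_mul hn0.le]
          congr 1; push_cast; ring
        have h1 := Real.sqrt_pos.mpr (hw n hn)
        simp only [g]
        rw [Set.indicator_of_mem hnN, Set.indicator_of_mem hnN, e,
          Real.sqrt_mul (inv_nonneg.mpr (hw0 n)), Real.sqrt_sq (by positivity), Real.sqrt_inv]
        apply le_of_eq
        field_simp
      · rw [Set.indicator_of_notMem hnN, norm_zero, zero_div]
        positivity
  obtain ⟨h1, h2⟩ := Real.summable_and_inner_le_Lp_mul_Lq_tsum_of_nonneg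
    (f := fun n => ‖f.1 n‖ * √(w n)) (g := fun n => √(g n)) Real.HolderConjugate.two_two
    (fun n => by positivity) (fun n => by positivity)
    (hf.congr fun n => by rw [Real.rpow_two, mul_pow, Real.sq_sqrt (hw0 n)])
    (hg.congr fun n => by rw [Real.rpow_two, Real.sq_sqrt (hg0 n)])
  simp only [Real.rpow_two, mul_pow, Real.sq_sqrt (hw0 _), Real.sq_sqrt (hg0 _),
    ← Real.sqrt_eq_rpow, ← norm_sq_eq, Real.sqrt_sq (norm_nonneg _)] at h2
  refine ⟨Summable.of_norm_bounded h1 hterm, ?_⟩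
  rw [mul_comm]
  exact (tsum_of_norm_bounded h1.hasSum hterm).trans h2

/-- The restriction to the words of the symbol of a bounded multiplication operator is bounded by
the norm of the operator. -/
lemma norm_lseries_restrictWords_le {σ₀ : ℝ} (hs : SummableWeight w σ₀)
    {T : space w hw →L[ℂ] space w hw} {φ : halfPlane σ₀ → ℂ}
    (hT : IsMultiplicationBy w hw σ₀ T φ) {N : ℕ} {s : ℂ}
    (h : Summable fun n : primeWords N => (w (n : ℕ))⁻¹ * ((n : ℕ) : ℝ) ^ (-(2 * s.re))) :
    ‖LSeries (restrictWords N (T (unitSeries w hw)).1) s‖ ≤ ‖T‖ := by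
  obtain ⟨C, hC⟩ := exists_norm_lseries_restrictWords_le (hw := hw) h
  set a := T (unitSeries w hw)
  set z := LSeries (restrictWords N a.1) s
  have hstep : ∀ f : space w hw, LSeries (restrictWords N (T f).1) s =
      z * LSeries (restrictWords N f.1) s := fun f => by
    rw [eq_convolution_of_lseries hs hT.lseries_unit (hT f), restrictWords_mul]
    exact ArithmeticFunction.LSeries_mul' (hC a).1 (hC f).1
  have hone : LSeries (restrictWords N (unitSeries w hw).1) s = 1 := by
    have : restrictWords N (unitSeries w hw).1 = (unitSeries w hw).1 := by
      ext n
      rw [restrictWords_apply]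
      by_cases hn : n ∈ primeWords N
      · rw [Set.indicator_of_mem hn]
      · have hn1 : n ≠ 1 := by
          rintro rfl
          exact hn (Nat.mem_factoredNumbers.mpr ⟨one_ne_zero, by simp⟩)
        rw [Set.indicator_of_notMem hn]
        exact (ArithmeticFunction.one_apply_ne hn1).symm
    rw [this, lseries_unitSeries]
  have hpow : ∀ k : ℕ, LSeries (restrictWords N ((T ^ k) (unitSeries w hw)).1) s = z ^ k := by
    intro k
    induction k with
    | zero => simpa using hone
    | succ k ih =>
      rw [pow_succ', mul_apply_eq_comp, hstep, ih, pow_succ']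
  -- Evaluation is bounded with some constant C, and z^k is the value for T^k 1; the constant
  -- disappears in the limit of k-th roots.
  refine le_of_pow_le_mul_pow (C := |C| * ‖unitSeries w hw‖) (norm_nonneg T) fun k => ?_
  calc ‖z‖ ^ k = ‖LSeries (restrictWords N ((T ^ k) (unitSeries w hw)).1) s‖ := by
        rw [hpow, norm_pow]
    _ ≤ |C| * ‖(T ^ k) (unitSeries w hw)‖ :=
        (hC _).2.trans (mul_le_mul_of_nonneg_right (le_abs_self C) (norm_nonneg _))
    _ ≤ |C| * (‖T‖ ^ k * ‖unitSeries w hw‖) := by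
        refine mul_le_mul_of_nonneg_left ?_ (abs_nonneg C)
        refine ((T ^ k).le_opNorm _).trans (mul_le_mul_of_nonneg_right ?_ (norm_nonneg _))
        rcases Nat.eq_zero_or_pos k with rfl | hk
        · rw [pow_zero, pow_zero]
          exact ContinuousLinearMap.norm_id_le
        · exact norm_pow_le' T hk
    _ = _ := by ring

lemma tendsto_lseries_restrictWords {a : ArithmeticFunction ℂ} {s : ℂ}
    (ha : LSeriesSummable a s) :
    Tendsto (fun N => LSeries (restrictWords N a) s) atTop (𝓝 (LSeries a s)) := by
  refine tendsto_tsum_of_dominated_convergence (Summable.norm ha) (fun n => ?_)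
    (Eventually.of_forall fun N n => norm_term_restrictWords_le N a s n)
  rcases eq_or_ne n 0 with rfl | hn
  · simp
  refine tendsto_const_nhds.congr' ?_
  filter_upwards [eventually_gt_atTop n] with N hN
  rw [LSeries.term_of_ne_zero hn, LSeries.term_of_ne_zero hn, restrictWords_apply,
    Set.indicator_of_mem (mem_primeWords_of_lt hn hN)]

/-- The restrictions of a series to the words converge to it uniformly on every half-plane of
absolute convergence. -/
lemma exists_norm_lseries_restrictWords_sub_le {a : ArithmeticFunction ℂ} {σ : ℝ}
    (ha : LSeriesSummable a σ) :
    ∃ r : ℕ → ℝ, Tendsto r atTop (𝓝 0) ∧ ∀ N M s, N ≤ M → σ ≤ s.re →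
      ‖LSeries (restrictWords N a) s - LSeries (restrictWords M a) s‖ ≤ r N := by
  have hsum : Summable fun n => ‖LSeries.term a σ n‖ := Summable.norm ha
  have hle : ∀ N n, (primeWords N)ᶜ.indicator (fun n => ‖LSeries.term a σ n‖) n ≤
      ‖LSeries.term a σ n‖ := fun N n =>
    Set.indicator_le_self' (fun _ _ => norm_nonneg _) n
  have h0 : ∀ N n, 0 ≤ (primeWords N)ᶜ.indicator (fun n => ‖LSeries.term a σ n‖) n := fun N n =>
    Set.indicator_nonneg (fun _ _ => norm_nonneg _) n
  have hsumN : ∀ N, Summable ((primeWords N)ᶜ.indicator fun n => ‖LSeries.term a σ n‖) :=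
    fun N => Summable.of_nonneg_of_le (h0 N) (hle N) hsum
  -- The rate is the absolute tail over the integers outside the N-th set of words, at the left edge
  -- σ.
  refine ⟨fun N => ∑' n, (primeWords N)ᶜ.indicator (fun n => ‖LSeries.term a σ n‖) n, ?_,
    fun N M s hNM hs => ?_⟩
  · have h := tendsto_tsum_of_dominated_convergence (𝓕 := atTop)
      (f := fun N n => (primeWords N)ᶜ.indicator (fun n => ‖LSeries.term a σ n‖) n)
      (g := fun _ => (0 : ℝ)) hsum (fun n => ?_) (Eventually.of_forall fun N n => by
        rw [Real.norm_of_nonneg (h0 N n)]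
        exact hle N n)
    · simpa only [tsum_zero] using h
    rcases eq_or_ne n 0 with rfl | hn
    · refine tendsto_const_nhds.congr fun N => ?_
      simp [Set.indicator]
    refine tendsto_const_nhds.congr' ?_
    filter_upwards [eventually_gt_atTop n] with N hN
    rw [Set.indicator_of_notMem]
    exact fun h => h (mem_primeWords_of_lt hn hN)
  · have has : LSeriesSummable a s := ha.of_re_le_re (by simpa using hs)
    have hsN : ∀ N, LSeriesSummable (restrictWords N a) s := fun N =>
      Summable.of_norm_bounded (Summable.norm has) fun n => norm_term_restrictWords_le N a s n
    rw [LSeries, LSeries, ← (hsN N).tsum_sub (hsN M)]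
    refine tsum_of_norm_bounded (hsumN N).hasSum fun n => ?_
    rcases eq_or_ne n 0 with rfl | hn
    · simpa using h0 N 0
    by_cases hnN : n ∈ primeWords N
    · rw [Set.indicator_of_notMem (Set.notMem_compl_iff.mpr hnN), LSeries.term_of_ne_zero hn,
        LSeries.term_of_ne_zero hn, restrictWords_apply, restrictWords_apply,
        Set.indicator_of_mem hnN, Set.indicator_of_mem (primeWords_mono hNM hnN), sub_self,
        norm_zero]
    · rw [Set.indicator_of_mem hnN, LSeries.term_of_ne_zero hn (f := restrictWords N a),
        restrictWords_apply, Set.indicator_of_notMem hnN, zero_div, zero_sub, norm_neg]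
      exact (norm_term_restrictWords_le M a s n).trans
        (LSeries.norm_term_le_of_re_le_re a (by simpa using hs) n)

/-! ### Multiplication operators and bounded Dirichlet series -/

/-- The symbol of a bounded multiplication operator extends to a bounded holomorphic function on
the larger half-plane, bounded by the norm of the operator. -/
lemma exists_boundedDirichlet_extension {δ σ₀ : ℝ} (hδ : δ ≤ σ₀) (hs : SummableWeight w σ₀)
    (hwords : ∀ N : ℕ, ∀ σ : ℝ, δ < σ → Summable fun n : primeWords N =>
      (w (n : ℕ))⁻¹ * ((n : ℕ) : ℝ) ^ (-(2 * σ)))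
    {T : space w hw →L[ℂ] space w hw} {φ : halfPlane σ₀ → ℂ}
    (hT : IsMultiplicationBy w hw σ₀ T φ) :
    ∃ F : boundedDirichlet δ, ‖F.1‖ ≤ ‖T‖ ∧
      ∀ (s : ℂ) (h : s ∈ halfPlane σ₀) (h' : s ∈ halfPlane δ), F.1 ⟨s, h'⟩ = φ ⟨s, h⟩ := by
  set a := T (unitSeries w hw)
  have hsum : ∀ s ∈ halfPlane σ₀, LSeriesSummable a.1 s := fun s h => lseriesSummable hs a h
  obtain ⟨r, hr, hr'⟩ := exists_norm_lseries_restrictWords_sub_le (a := a.1) (σ := σ₀ + 1)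
    (hsum _ (by simp [halfPlane]))
  obtain ⟨F, hFd, hFB, hFlim⟩ := exists_bounded_limit (δ := δ) (σ₁ := σ₀ + 1) (B := ‖T‖)
    (by linarith) (φ := fun N => LSeries (restrictWords N a.1)) (fun N => by
      refine (LSeries_differentiableOn _).mono fun s (h : δ < s.re) => ?_
      refine lt_of_le_of_lt (b := (δ : EReal)) ?_ (by exact_mod_cast h)
      refine LSeries.abscissaOfAbsConv_le_of_forall_lt_LSeriesSummable fun y hy => ?_
      obtain ⟨C, hC⟩ := exists_norm_lseries_restrictWords_le (hw := hw) (N := N) (s := y)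
        (hwords N y hy)
      exact (hC a).1)
    (fun N s h => norm_lseries_restrictWords_le hs hT (hwords N s.re h)) hr hr'
  have hFa : ∀ s ∈ halfPlane σ₀, F s = LSeries a.1 s := fun s h =>
    tendsto_nhds_unique (hFlim s (hδ.trans_lt h)) (tendsto_lseries_restrictWords (hsum s h))
  have hcont : Continuous fun s : halfPlane δ => F s :=
    continuousOn_iff_continuous_domRestrict.mp hFd.continuousOn
  refine ⟨⟨BoundedContinuousFunction.ofNormedAddCommGroup (fun s : halfPlane δ => F s) hcont ‖T‖
    fun s => hFB s s.2, ⟨F, hFd, fun _ => rfl⟩, ?_⟩, ?_, fun s h h' => ?_⟩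
  · rw [isDirichletRepresentable_iff]
    refine ⟨a.1, σ₀, fun s h => ?_⟩
    have := (hsum s h).LSeriesHasSum
    rwa [← hFa s h] at this
  · exact BoundedContinuousFunction.norm_ofNormedAddCommGroup_le hcont (norm_nonneg _)
      fun s => hFB s s.2
  · exact (hFa s h).trans (hT.lseries_unit ⟨s, h⟩)

/-- The identity theorem on the connected half-plane: a symbol on the smaller half-plane has at most
one holomorphic extension. -/
lemma eqOn_halfPlane {δ σ₀ : ℝ} (hδ : δ ≤ σ₀) {F G : ℂ → ℂ}
    (hF : DifferentiableOn ℂ F (halfPlane δ)) (hG : DifferentiableOn ℂ G (halfPlane δ))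
    (h : ∀ s ∈ halfPlane σ₀, F s = G s) : Set.EqOn F G (halfPlane δ) := by
  have hz : ((σ₀ + 1 : ℝ) : ℂ) ∈ halfPlane σ₀ := by simp [halfPlane]
  refine (hF.analyticOnNhd (isOpen_halfPlane δ)).eqOn_of_preconnected_of_eventuallyEq
    (hG.analyticOnNhd (isOpen_halfPlane δ)) (convex_halfSpace_re_gt δ).isPreconnected
    (hδ.trans_lt hz) ?_
  filter_upwards [(isOpen_halfPlane σ₀).mem_nhds hz] with s hs using h s hs

lemma halfPlane_anti {δ σ₀ : ℝ} (hδ : δ ≤ σ₀) : halfPlane σ₀ ⊆ halfPlane δ :=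
  fun _ hs => hδ.trans_lt hs

lemma boundedDirichlet_ext {δ σ₀ : ℝ} (hδ : δ ≤ σ₀) {F G : boundedDirichlet δ}
    (h : ∀ s (hs : s ∈ halfPlane σ₀),
      F.1 ⟨s, halfPlane_anti hδ hs⟩ = G.1 ⟨s, halfPlane_anti hδ hs⟩) :
    F = G := by
  obtain ⟨F', hF', hF⟩ := F.2.1
  obtain ⟨G', hG', hG⟩ := G.2.1
  have := eqOn_halfPlane hδ hF' hG' fun s hs => by
    rw [← hF ⟨s, halfPlane_anti hδ hs⟩, ← hG ⟨s, halfPlane_anti hδ hs⟩, h s hs]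
  ext s
  rw [hF, hG]
  exact this s.2

/-- A bounded Dirichlet series multiplies the space into itself, with norm at most its supremum
norm. -/
lemma exists_operator_of_boundedDirichlet {δ σ₀ : ℝ} (hδ : δ ≤ σ₀) (hs : SummableWeight w σ₀)
    (hmul : w.IsMultiplicative)
    (hdec : ∀ p : ℕ, p.Prime → ∀ k : ℕ, 1 ≤ k →
      w (p ^ k) ≤ (p : ℝ) ^ (-(2 * δ)) * w (p ^ (k - 1)))
    (F : boundedDirichlet δ) :
    ∃ T : space w hw →L[ℂ] space w hw, ‖T‖ ≤ ‖F.1‖ ∧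
      IsMultiplicationBy w hw σ₀ T fun s => F.1 ⟨s, halfPlane_anti hδ s.2⟩ := by
  obtain ⟨G, hG, hFG⟩ := F.2.1
  obtain ⟨a', σ, ha'⟩ := (isDirichletRepresentable_iff _).mp F.2.2
  set a : ArithmeticFunction ℂ := ⟨fun n => if n = 0 then 0 else a' n, by simp⟩
  set τ := max σ σ₀
  have ha : ∀ s : ℂ, τ < s.re → LSeriesHasSum a s (G s) := fun s h => by
    have hsδ : s ∈ halfPlane δ := hδ.trans_lt ((le_max_right _ _).trans_lt h)
    have h1 := ha' ⟨s, hsδ⟩ ((le_max_left _ _).trans_lt h)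
    rw [hFG] at h1
    refine (LSeriesHasSum_congr _ _ fun {n} hn => ?_).mp h1
    exact (if_neg hn).symm
  have hB : ∀ s ∈ halfPlane δ, ‖G s‖ ≤ ‖F.1‖ := fun s h => by
    rw [← hFG ⟨s, h⟩]
    exact F.1.norm_coe_le_norm _
  have hmem := fun f : space w hw => convolution_mem_space hmul hdec hG hB ha f
  -- Applying the bound to the series 1 puts a itself in the space. Its series therefore converges
  -- on the whole half-plane of abscissa σ₀, not only beyond τ, and equals G there by the identity
  -- theorem.
  have ha1 : a ∈ space w hw := by
    obtain ⟨h1, -⟩ := hmem (unitSeries w hw)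
    have : a * (unitSeries w hw).1 = a := mul_one a
    rwa [this] at h1
  have hGa : ∀ s ∈ halfPlane σ₀, LSeries a s = G s := by
    refine eqOn_halfPlane (le_max_right σ σ₀) ?_ (hG.mono fun s h => hδ.trans_lt h)
      fun s h => (ha s h).LSeries_eq
    refine (LSeries_differentiableOn a).mono fun s (h : σ₀ < s.re) => ?_
    exact (abscissa_le hs ⟨a, ha1⟩).trans_lt (by exact_mod_cast h)
  let L : space w hw →ₗ[ℂ] space w hw :=
    { toFun := fun f => ⟨a * f.1, (hmem f).1⟩
      map_add' := fun f g => Subtype.ext (mul_add a f.1 g.1)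
      map_smul' := fun c f => Subtype.ext <| by
        ext n
        change (a * (c • f.1)) n = c * (a * f.1) n
        rw [ArithmeticFunction.mul_apply, ArithmeticFunction.mul_apply, Finset.mul_sum]
        refine Finset.sum_congr rfl fun x _ => ?_
        change a x.1 * (c * f.1 x.2) = _
        ring }
  refine ⟨L.mkContinuous ‖F.1‖ fun f => (hmem f).2,
    L.mkContinuous_norm_le (norm_nonneg _) _, fun f s => ?_⟩
  refine (ArithmeticFunction.LSeries_mul' (lseriesSummable hs ⟨a, ha1⟩ s.2)
    (lseriesSummable hs f s.2)).trans ?_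
  exact congrArg (· * LSeries f.1 s) ((hGa s s.2).trans (hFG ⟨s, halfPlane_anti hδ s.2⟩).symm)

lemma IsMultiplicationBy.unique {σ₀ : ℝ} (hs : SummableWeight w σ₀)
    {S T : space w hw →L[ℂ] space w hw} {φ : halfPlane σ₀ → ℂ}
    (hS : IsMultiplicationBy w hw σ₀ S φ) (hT : IsMultiplicationBy w hw σ₀ T φ) : S = T := by
  ext1 f
  refine Subtype.ext (eq_of_lseries_eqOn (σ₀ := σ₀)
    ((abscissa_le hs _).trans_lt (EReal.coe_lt_top _))
    ((abscissa_le hs _).trans_lt (EReal.coe_lt_top _)) fun s h => ?_)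
  rw [hS f ⟨s, h⟩, hT f ⟨s, h⟩]

lemma IsMultiplicationBy.isMultiplier {σ₀ : ℝ} {T : space w hw →L[ℂ] space w hw}
    {φ : halfPlane σ₀ → ℂ} (h : IsMultiplicationBy w hw σ₀ T φ) : IsMultiplier w hw σ₀ φ :=
  fun f => ⟨T f, h f⟩

lemma IsMultiplicationBy.mul {σ₀ : ℝ} {S T : space w hw →L[ℂ] space w hw}
    {φ ψ : halfPlane σ₀ → ℂ} (hS : IsMultiplicationBy w hw σ₀ S φ)
    (hT : IsMultiplicationBy w hw σ₀ T ψ) : IsMultiplicationBy w hw σ₀ (S * T) (φ * ψ) :=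
  fun f s => by
    change LSeries (S (T f)).1 s = _
    rw [hS, hT, Pi.mul_apply, mul_assoc]

lemma IsMultiplicationBy.add {σ₀ : ℝ} (hs : SummableWeight w σ₀)
    {S T : space w hw →L[ℂ] space w hw} {φ ψ : halfPlane σ₀ → ℂ}
    (hS : IsMultiplicationBy w hw σ₀ S φ) (hT : IsMultiplicationBy w hw σ₀ T ψ) :
    IsMultiplicationBy w hw σ₀ (S + T) (φ + ψ) := fun f s => by
  have e : (((S + T) f).1 : ℕ → ℂ) = ((S f).1 : ℕ → ℂ) + ((T f).1 : ℕ → ℂ) := rfl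
  rw [e, LSeries_add (lseriesSummable hs _ s.2) (lseriesSummable hs _ s.2), hS, hT,
    Pi.add_apply, add_mul]

lemma IsMultiplicationBy.smul {σ₀ : ℝ} {T : space w hw →L[ℂ] space w hw}
    {φ : halfPlane σ₀ → ℂ} (c : ℂ) (hT : IsMultiplicationBy w hw σ₀ T φ) :
    IsMultiplicationBy w hw σ₀ (c • T) (c • φ) := fun f s => by
  have e : (((c • T) f).1 : ℕ → ℂ) = c • ((T f).1 : ℕ → ℂ) := rfl
  rw [e, LSeries_smul, hT, Pi.smul_apply, smul_eq_mul, mul_assoc]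

lemma isMultiplicationBy_one {σ₀ : ℝ} :
    IsMultiplicationBy w hw σ₀ (1 : space w hw →L[ℂ] space w hw) 1 := fun f s => by
  rw [Pi.one_apply, one_mul]
  rfl

end DirichletMultiplier

end

/-! ### The isometric isomorphism -/

theorem mainTheorem2 (w : ArithmeticFunction ℝ) (hw : ∀ n, n ≠ 0 → 0 < w n)
    (δ Δ Δ' : ℝ) (hδ : 0 ≤ δ) (hδΔ : δ = Δ) (hΔ : Δ ≤ Δ')
    (hfull : DirichletMultiplier.SummableWeight w Δ')
    (hwords : ∀ N : ℕ, ∀ σ : ℝ, Δ < σ → Summable fun n : DirichletMultiplier.primeWords N =>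
      (w (n : ℕ))⁻¹ * ((n : ℕ) : ℝ) ^ (-(2 * σ)))
    (hmul : w.IsMultiplicative)
    (hdec : ∀ p : ℕ, p.Prime → ∀ k : ℕ, 1 ≤ k →
      w (p ^ k) ≤ (p : ℝ) ^ (-(2 * δ)) * w (p ^ (k - 1))) :
    (∀ φ : DirichletMultiplier.halfPlane Δ' → ℂ,
      DirichletMultiplier.IsMultiplier w hw Δ' φ →
        ∃ T ∈ DirichletMultiplier.multiplierAlgebra w hw Δ' hfull,
          DirichletMultiplier.IsMultiplicationBy w hw Δ' T φ) ∧
    ∃ Φ : DirichletMultiplier.multiplierAlgebra w hw Δ' hfull ≃ₐ[ℂ]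
        DirichletMultiplier.boundedDirichlet δ,
      (∀ T, ‖(Φ T).1‖ = ‖T.1‖) ∧
      ∀ T (φ : DirichletMultiplier.halfPlane Δ' → ℂ),
        DirichletMultiplier.IsMultiplicationBy w hw Δ' T.1 φ →
        ∀ (s : ℂ) (hs : s ∈ DirichletMultiplier.halfPlane Δ')
          (hs' : s ∈ DirichletMultiplier.halfPlane δ), (Φ T).1 ⟨s, hs'⟩ = φ ⟨s, hs⟩ := by
  open DirichletMultiplier in
  subst hδΔ
  refine ⟨fun φ hφ => ?_, ?_⟩
  · obtain ⟨T, hT⟩ := hφ.exists_operator hfull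
    exact ⟨T, ⟨φ, hφ, hT⟩, hT⟩
  let res : boundedDirichlet δ → halfPlane Δ' → ℂ :=
    fun F s => F.1 ⟨s, halfPlane_anti hΔ s.2⟩
  have hop := fun F : boundedDirichlet δ =>
    exists_operator_of_boundedDirichlet (hw := hw) hΔ hfull hmul hdec F
  choose S hSn hS using hop
  have hS' : ∀ F, IsMultiplicationBy w hw Δ' (S F) (res F) := hS
  let Ψ : boundedDirichlet δ →ₐ[ℂ] multiplierAlgebra w hw Δ' hfull :=
    AlgHom.ofLinearMap
      { toFun := fun F => ⟨S F, res F, (hS' F).isMultiplier, hS' F⟩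
        map_add' := fun F G => Subtype.ext <|
          (hS' (F + G)).unique hfull ((hS' F).add hfull (hS' G))
        map_smul' := fun c F => Subtype.ext <|
          (hS' (c • F)).unique hfull ((hS' F).smul c) }
      (Subtype.ext <| (hS' 1).unique hfull isMultiplicationBy_one)
      (fun F G => Subtype.ext <| (hS' (F * G)).unique hfull ((hS' F).mul (hS' G)))
  have hsymbol : ∀ (F : boundedDirichlet δ) (φ : halfPlane Δ' → ℂ),
      IsMultiplicationBy w hw Δ' (S F) φ → res F = φ := fun F φ h => by
    funext s
    rw [← (hS' F).lseries_unit s, h.lseries_unit s]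
  have hextend := fun (T : space w hw →L[ℂ] space w hw) (φ : halfPlane Δ' → ℂ)
    (hT : IsMultiplicationBy w hw Δ' T φ) =>
      exists_boundedDirichlet_extension hΔ hfull hwords hT
  have hinj : Function.Injective Ψ := fun F G h => by
    have h' : S F = S G := congrArg Subtype.val h
    have h2 := hsymbol G (res F) (h' ▸ hS' F)
    exact boundedDirichlet_ext hΔ fun s hs => (congrFun h2 ⟨s, hs⟩).symm
  have hsurj : Function.Surjective Ψ := by
    rintro ⟨T, φ, hφ, hT⟩
    obtain ⟨F, -, hF⟩ := hextend T φ hT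
    have : res F = φ := funext fun s => hF s s.2 _
    exact ⟨F, Subtype.ext <| (hS' F).unique hfull (this ▸ hT)⟩
  -- The extension of the restricted symbol is F again, so its bound by ‖S F‖ supplies the
  -- inequality opposite to `hSn`.
  have hnorm : ∀ F, ‖F.1‖ = ‖S F‖ := fun F => by
    refine le_antisymm ?_ (hSn F)
    obtain ⟨G, hG, hGF⟩ := hextend (S F) (res F) (hS' F)
    have : G = F := boundedDirichlet_ext hΔ fun s hs => hGF s hs _
    rwa [this] at hG
  let E := AlgEquiv.ofBijective Ψ ⟨hinj, hsurj⟩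
  refine ⟨E.symm, fun T => ?_, fun T φ hT s hs hs' => ?_⟩
  · obtain ⟨F, rfl⟩ := E.surjective T
    rw [E.symm_apply_apply]
    exact hnorm F
  · obtain ⟨F, rfl⟩ := E.surjective T
    rw [E.symm_apply_apply]
    exact congrFun (hsymbol F φ hT) ⟨s, hs⟩
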